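/- **Model.** There are $p$ processors, and words are real numbers. Each entry of the input matrices $A\in\mathbb R^{m\times n}$, $W\in\mathbb R^{m\times k}$, $H\in\mathbb R^{k\times n}$ is initially stored on exactly one processor. An algorithm runs in finitely many communication steps; in one step each processor may send at most one message to another processor and receive at most one message (fully connected network, bidirectional links). Which messages are sent, and their numbers of words, are fixed in advance. The words of a message are computed by the sender from the words it stores (its own input entries and all words received before), by any finite number of operations $+,-,\times,\div$, real constants and branching on comparisons; local computation and memory are free. The algorithm *computes* a matrix if at the end every entry of it is available, for all real inputs $A,W,H$, on a processor assigned to this entry. The number of words *along the critical path* is the maximum, over all sequences of messages sent in successively later steps such that any two consecutive messages have a processor in common (as sender or receiver), of the total number of words of these messages. A distribution of a matrix with $N$ entries is *load balanced up to a factor $c$* if every processor is assigned at most $\lceil cN/p\rceil$ entries. **Theorem.** For every real $c\ge 1$ there is a constant $\alpha>0$, depending only on $c$, such that the following holds for all integers $m,n,k\ge 0$ and $p\ge 2c$ with $k<n\le m$ and $k<\sqrt{mn/p}$. Let an algorithm on $p$ processors as above, with input $A\in\mathbb R^{m\times n}$, $W\in\mathbb R^{m\times k}$, $H\in\mathbb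 R^{k\times n}$ (dense: the entries are arbitrary), compute $W^TA$ or compute $AH^T$ (or both), where in the first case the distributions of $A$, $W$ and $W^TA$, in the second case those of $A$, $H$ and $AH^T$, are load balanced up to the factor $c$. Then the number of words that it communicates along its critical path is at least $$\alpha\,\min\left\{\sqrt{mnk^2/p},\;nk\right\}.$$ In particular (for $c=1$) this holds with an absolute constant $\alpha>0$ for exactly balanced distributions and all $p\ge 2$. -/

import Mathlib

/-! A distributed-memory machine with `p` processors working on real data. The input is a family of
real numbers indexed by a type `E` of entries; a word is a real number, so a word occurring in the
run of an algorithm is a function `(E → ℝ) → ℝ` of the input. -/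

namespace DistMM

/-- `Computable K f`: the word `f` can be obtained by local computation from the words in `K`, using
real constants, the four arithmetic operations and branching on comparisons. (The value of a
quotient with denominator `0` is `0`.) -/
inductive Computable {E : Type} (K : Set ((E → ℝ) → ℝ)) : ((E → ℝ) → ℝ) → Prop
  | known {f : (E → ℝ) → ℝ} : f ∈ K → Computable K f
  | const (a : ℝ) : Computable K (fun _ => a)
  | add {f g : (E → ℝ) → ℝ} : Computable K f → Computable K g → Computable K (fun x => f x + g x)
  | sub {f g : (E → ℝ) → ℝ} : Computable K f → Computable K g → Computable K (fun x => f x - g x)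
  | mul {f g : (E → ℝ) → ℝ} : Computable K f → Computable K g → Computable K (fun x => f x * g x)
  | div {f g : (E → ℝ) → ℝ} : Computable K f → Computable K g → Computable K (fun x => f x / g x)
  | branch {f g h h' : (E → ℝ) → ℝ} {b : (E → ℝ) → ℝ} :
      Computable K f → Computable K g → Computable K h → Computable K h' →
      (∀ x, f x ≤ g x → b x = h x) → (∀ x, ¬ f x ≤ g x → b x = h' x) → Computable K b

/-- A message: its destination and the words that it consists of. -/
structure Message (p : ℕ) (E : Type) where
  dst : Fin p
  words : List ((E → ℝ) → ℝ)

/-- The data of a distributed algorithm: the processor that stores each input entry at the start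
(every entry is stored once), the number of communication steps, and the message, if any, that each
processor sends in each step. Only the steps `t < steps` are executed. -/
structure Schedule (p : ℕ) (E : Type) where
  owner : E → Fin p
  steps : ℕ
  msg : ℕ → Fin p → Option (Message p E)

namespace Schedule

variable {p : ℕ} {E : Type}

/-- The words stored by processor `q` before step `t`: the input entries that it owns and the words
that it has received. -/
def stored (S : Schedule p E) (t : ℕ) (q : Fin p) : Set ((E → ℝ) → ℝ) :=
  {f | ∃ e, S.owner e = q ∧ f = fun x => x e} ∪
  {f | ∃ s < t, ∃ r M, S.msg s r = some M ∧ M.dst = q ∧ f ∈ M.words}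

/-- The largest number of words on a path of messages that were sent in the steps before `t` and
that ends at processor `q`. Two messages follow each other on a path if the second one is sent in a
later step and they have a processor (as sender or receiver) in common; messages that are not on a
common path may be transferred simultaneously. -/
def pathWords (S : Schedule p E) : ℕ → Fin p → ℕ
  | 0, _ => 0
  | t + 1, q => max (S.pathWords t q) (Finset.univ.sup fun r : Fin p =>
      match S.msg t r with
      | none => 0
      | some M =>
        if r = q ∨ M.dst = q then max (S.pathWords t r) (S.pathWords t M.dst) + M.words.length
        else 0)

/-- The number of words communicated along the critical path. -/
def criticalPathWords (S : Schedule p E) : ℕ :=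
  Finset.univ.sup fun q : Fin p => S.pathWords S.steps q

end Schedule

/-- A distributed-memory parallel algorithm on `p` processors. The network is fully connected with
bidirectional links: in one step a processor sends at most one message and receives at most one. The
words of a message are computed by the sender from what it has stored. Local memory and local
computation are not limited. -/
structure Algorithm (p : ℕ) (E : Type) extends Schedule p E where
  dst_ne : ∀ t < steps, ∀ q M, msg t q = some M → M.dst ≠ q
  receive_one : ∀ t < steps, ∀ q q' M M',
    msg t q = some M → msg t q' = some M' → M.dst = M'.dst → q = q'
  computes_words : ∀ t < steps, ∀ q M, msg t q = some M →
    ∀ f ∈ M.words, Computable (toSchedule.stored t q) f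

/-- `loc` distributes the entries of a matrix with index set `ι` over `p` processors. It is load
balanced up to the factor `c` if every processor gets at most `⌈c |ι| / p⌉` entries. -/
def Balanced {ι : Type} [Fintype ι] {p : ℕ} (c : ℝ) (loc : ι → Fin p) : Prop :=
  ∀ q, (Finset.univ.filter fun e => loc e = q).card ≤ ⌈c * (Fintype.card ι : ℝ) / (p : ℝ)⌉₊

/-- At the end of the algorithm, the entry `e` of the matrix `out` (whose entries are functions of
the input) is available on processor `loc e`. -/
def Algorithm.Outputs {p : ℕ} {E ι : Type} (P : Algorithm p E) (loc : ι → Fin p)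
    (out : (E → ℝ) → ι → ℝ) : Prop :=
  ∀ e, Computable (P.stored P.steps (loc e)) (fun x => out x e)

/-- Index set of the entries of `A` (`m × n`), `W` (`m × k`) and `H` (`k × n`). -/
abbrev Entry (m n k : ℕ) : Type := (Fin m × Fin n) ⊕ ((Fin m × Fin k) ⊕ (Fin k × Fin n))

section

variable {m n k p : ℕ}

/-- The matrix `A` of an input. -/
def matA (x : Entry m n k → ℝ) : Matrix (Fin m) (Fin n) ℝ := fun i j => x (Sum.inl (i, j))

/-- The matrix `W` of an input. -/
def matW (x : Entry m n k → ℝ) : Matrix (Fin m) (Fin k) ℝ := fun i l => x (Sum.inr (Sum.inl (i, l)))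

/-- The matrix `H` of an input. -/
def matH (x : Entry m n k → ℝ) : Matrix (Fin k) (Fin n) ℝ := fun l j => x (Sum.inr (Sum.inr (l, j)))

/-- The algorithm computes `Wᵀ A`, and the distributions of `A`, `W` and of the result are load
balanced up to the factor `c`. -/
def ComputesWtA (P : Algorithm p (Entry m n k)) (c : ℝ) : Prop :=
  Balanced c (fun e : Fin m × Fin n => P.owner (Sum.inl e)) ∧
  Balanced c (fun e : Fin m × Fin k => P.owner (Sum.inr (Sum.inl e))) ∧
  ∃ loc : Fin k × Fin n → Fin p, Balanced c loc ∧
    P.Outputs loc fun x e => ((matW x).transpose * matA x) e.1 e.2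

/-- The algorithm computes `A Hᵀ`, and the distributions of `A`, `H` and of the result are load
balanced up to the factor `c`. -/
def ComputesAHt (P : Algorithm p (Entry m n k)) (c : ℝ) : Prop :=
  Balanced c (fun e : Fin m × Fin n => P.owner (Sum.inl e)) ∧
  Balanced c (fun e : Fin k × Fin n => P.owner (Sum.inr (Sum.inr e))) ∧
  ∃ loc : Fin m × Fin k → Fin p, Balanced c loc ∧
    P.Outputs loc fun x e => (matA x * (matH x).transpose) e.1 e.2

end

end DistMM

/-! Fix a processor `q` and let w be twice the number of words along the critical path; `q`
exchanges at most w words. At a suitable generic input, all words are analytic functions of the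
input. Take a direction η changing only entries owned by `q` and a direction ω changing only other
entries, both leaving the traffic of `q` stationary. Then words on `q` do not react to ω to first
order, words elsewhere do not react to η, and every stored word has zero mixed derivative along η
and ω (`Algorithm.flat_stored`). Stationarity costs at most w linear equations for each direction.

For WᵀA this gives two constraints (`Algorithm.communication_bounds`). First, results off `q` ignore
η; since the relevant minors of W are invertible, the sum over j of the minimum of the number of
entries of column j of A on `q` and the number of results of column j off `q` is at most w. Second,
the mixed derivative of the output is a sum over i of ω_il η_ij. Its vanishing makes columns of A on
`q` orthogonal to columns of W off `q`, so their supports overlap in at most u_l + v_j places, where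
the u_l and the v_j each sum to at most w.

Load balance forces a sixth of the mnk products to have entries on different processors, and some
`q` holds an average share of them (`exists_processor_nonlocal_products`). The constraints bound
this share in terms of w (`sum_products_le`). If w is below a small multiple of kD, with D =
min(√(mn/p), n), that bound is too small (`products_bound_lt`). The product AHᵀ reduces to this case
by transposition. -/

namespace DistMM

open Filter Topology

/-! ### First-order and mixed second-order flatness -/

section Flat

variable {V : Type*} [NormedAddCommGroup V] [NormedSpace ℝ V]

/-- The mixed second directional derivative. -/
noncomputable def mixedDeriv (η ω : V) (f : V → ℝ) (x : V) : ℝ :=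
  fderiv ℝ (fun y => fderiv ℝ f y ω) x η

/-- `f` has vanishing derivative along `v` and vanishing mixed derivative along `η`, `ω`. -/
def Flat (v η ω : V) (f : V → ℝ) (x : V) : Prop :=
  fderiv ℝ f x v = 0 ∧ mixedDeriv η ω f x = 0

variable {v η ω x : V} {f g : V → ℝ}

theorem Flat.congr (h : Flat v η ω f x) (hfg : g =ᶠ[𝓝 x] f) : Flat v η ω g x := by
  have h1 : fderiv ℝ g =ᶠ[𝓝 x] fderiv ℝ f := hfg.fderiv
  refine ⟨by rw [hfg.fderiv_eq]; exact h.1, ?_⟩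
  have h2 : (fun y => fderiv ℝ g y ω) =ᶠ[𝓝 x] fun y => fderiv ℝ f y ω := by
    filter_upwards [h1] with y hy
    rw [hy]
  have := h.2
  unfold mixedDeriv at this ⊢
  rw [h2.fderiv_eq, this]

theorem flat_const (a : ℝ) : Flat v η ω (fun _ : V => a) x := by
  simp [Flat, mixedDeriv]

theorem differentiableAt_fderiv_apply (hf : AnalyticAt ℝ f x) (ω : V) :
    DifferentiableAt ℝ (fun y => fderiv ℝ f y ω) x :=
  hf.fderiv.differentiableAt.clm_apply (differentiableAt_const ω)

theorem mixedDeriv_add (hf : AnalyticAt ℝ f x) (hg : AnalyticAt ℝ g x) :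
    mixedDeriv η ω (fun y => f y + g y) x = mixedDeriv η ω f x + mixedDeriv η ω g x := by
  have h : (fun y => fderiv ℝ (fun y => f y + g y) y ω) =ᶠ[𝓝 x]
      fun y => fderiv ℝ f y ω + fderiv ℝ g y ω := by
    filter_upwards [hf.eventually_analyticAt, hg.eventually_analyticAt] with y h1 h2
    rw [fderiv_fun_add h1.differentiableAt h2.differentiableAt]
    rfl
  unfold mixedDeriv
  rw [h.fderiv_eq, fderiv_fun_add (differentiableAt_fderiv_apply hf ω)
    (differentiableAt_fderiv_apply hg ω)]
  rfl

theorem mixedDeriv_mul (hf : AnalyticAt ℝ f x) (hg : AnalyticAt ℝ g x) :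
    mixedDeriv η ω (fun y => f y * g y) x =
      f x * mixedDeriv η ω g x + fderiv ℝ f x η * fderiv ℝ g x ω +
        (g x * mixedDeriv η ω f x + fderiv ℝ g x η * fderiv ℝ f x ω) := by
  have h : (fun y => fderiv ℝ (fun y => f y * g y) y ω) =ᶠ[𝓝 x]
      fun y => f y * fderiv ℝ g y ω + g y * fderiv ℝ f y ω := by
    filter_upwards [hf.eventually_analyticAt, hg.eventually_analyticAt] with y h1 h2
    rw [fderiv_fun_mul h1.differentiableAt h2.differentiableAt]
    rfl
  unfold mixedDeriv
  have hf' := differentiableAt_fderiv_apply hf ω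
  have hg' := differentiableAt_fderiv_apply hg ω
  rw [h.fderiv_eq, fderiv_fun_add (hf.differentiableAt.fun_mul hg') (hg.differentiableAt.fun_mul hf'),
    fderiv_fun_mul hf.differentiableAt hg', fderiv_fun_mul hg.differentiableAt hf']
  simp only [add_apply, smul_apply, smul_eq_mul]
  ring

theorem Flat.add (hf : AnalyticAt ℝ f x) (hg : AnalyticAt ℝ g x)
    (h1 : Flat v η ω f x) (h2 : Flat v η ω g x) : Flat v η ω (fun y => f y + g y) x := by
  refine ⟨?_, by rw [mixedDeriv_add hf hg, h1.2, h2.2, add_zero]⟩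
  rw [fderiv_fun_add hf.differentiableAt hg.differentiableAt]
  simp [h1.1, h2.1]

/-- The mixed derivative of a product has the cross terms f_η g_ω and g_η f_ω. Each contains a
derivative along `v`, which is why flatness includes a first-order condition and `v` must be one of
the two directions. -/
theorem Flat.mul (hv : v = η ∨ v = ω) (hf : AnalyticAt ℝ f x) (hg : AnalyticAt ℝ g x)
    (h1 : Flat v η ω f x) (h2 : Flat v η ω g x) : Flat v η ω (fun y => f y * g y) x := by
  constructor
  · rw [fderiv_fun_mul hf.differentiableAt hg.differentiableAt]
    simp [h1.1, h2.1]
  · rw [mixedDeriv_mul hf hg, h1.2, h2.2]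
    have h3 := h1.1
    have h4 := h2.1
    rcases hv with rfl | rfl <;> simp [h3, h4]

theorem Flat.sub (hv : v = η ∨ v = ω) (hf : AnalyticAt ℝ f x) (hg : AnalyticAt ℝ g x)
    (h1 : Flat v η ω f x) (h2 : Flat v η ω g x) : Flat v η ω (fun y => f y - g y) x := by
  have h3 : Flat v η ω (fun y => f y + (fun _ => -1) y * g y) x :=
    h1.add hf (analyticAt_const.mul hg) ((flat_const (-1)).mul hv analyticAt_const hg h2)
  exact h3.congr (Eventually.of_forall fun y => by ring)

theorem Flat.div (hv : v = η ∨ v = ω) (hf : AnalyticAt ℝ f x) (hg : AnalyticAt ℝ g x)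
    (hx : g x ≠ 0) (h1 : Flat v η ω f x) (h2 : Flat v η ω g x) :
    Flat v η ω (fun y => f y / g y) x := by
  have hh : AnalyticAt ℝ (fun y => f y / g y) x := hf.div hg hx
  -- The product rule for numerator = quotient · denominator is solved for the derivatives of the
  -- quotient.
  have he : f =ᶠ[𝓝 x] fun y => (fun y => f y / g y) y * g y := by
    filter_upwards [hg.continuousAt.eventually_ne hx] with y hy
    field_simp
  have h3 : fderiv ℝ (fun y => f y / g y) x v = 0 := by
    have := h1.1
    rw [he.fderiv_eq, fderiv_fun_mul hh.differentiableAt hg.differentiableAt] at this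
    simpa [h2.1, hx] using this
  refine ⟨h3, ?_⟩
  have h4 : Flat v η ω (fun y => (fun y => f y / g y) y * g y) x := h1.congr he.symm
  have h5 := h4.2
  rw [mixedDeriv_mul hh hg, h2.2] at h5
  have h6 := h2.1
  rcases hv with rfl | rfl <;> simpa [h3, h6, hx] using h5

end Flat

/-! ### Generic analyticity of local computation -/

variable {E : Type} [Fintype E]

/-- On the set `U`, the function `f` is analytic, and it is flat wherever all functions in `K`
are. -/
def Transfers (K : Set ((E → ℝ) → ℝ)) (f : (E → ℝ) → ℝ) (U : Set (E → ℝ)) : Prop :=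
  ∀ x ∈ U, AnalyticAt ℝ f x ∧ ∀ v η ω : E → ℝ, (v = η ∨ v = ω) →
    (∀ g ∈ K, Flat v η ω g x) → Flat v η ω f x

theorem Transfers.mono {K : Set ((E → ℝ) → ℝ)} {f : (E → ℝ) → ℝ} {U U' : Set (E → ℝ)}
    (h : Transfers K f U) (hU : U' ⊆ U) : Transfers K f U' :=
  fun x hx => h x (hU hx)

theorem Transfers.congr {K : Set ((E → ℝ) → ℝ)} {f g : (E → ℝ) → ℝ} {U : Set (E → ℝ)}
    (h : Transfers K f U) (hU : IsOpen U) (hfg : ∀ x ∈ U, g x = f x) : Transfers K g U := by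
  intro x hx
  have he : g =ᶠ[𝓝 x] f := by
    filter_upwards [hU.mem_nhds hx] with y hy using hfg y hy
  exact ⟨(h x hx).1.congr he.symm, fun v η ω hv hK => ((h x hx).2 v η ω hv hK).congr he⟩

theorem transfers_const {K : Set ((E → ℝ) → ℝ)} (a : ℝ) (U : Set (E → ℝ)) :
    Transfers K (fun _ => a) U :=
  fun _ _ => ⟨analyticAt_const, fun _ _ _ _ _ => flat_const a⟩

theorem Transfers.continuousOn {K : Set ((E → ℝ) → ℝ)} {f : (E → ℝ) → ℝ} {U : Set (E → ℝ)}
    (h : Transfers K f U) : ContinuousOn f U :=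
  fun x hx => (h x hx).1.continuousAt.continuousWithinAt

/-- Local computation is generically analytic, and transfers flatness. -/
theorem Computable.exists_transfers {K : Set ((E → ℝ) → ℝ)} {f : (E → ℝ) → ℝ}
    (hf : Computable K f) {U : Set (E → ℝ)} (hU : IsOpen U) (hne : U.Nonempty)
    (hK : ∀ g ∈ K, ∀ x ∈ U, AnalyticAt ℝ g x) :
    ∃ U' ⊆ U, IsOpen U' ∧ U'.Nonempty ∧ Transfers K f U' := by
  induction hf generalizing U with
  | known h => exact ⟨U, subset_rfl, hU, hne, fun x hx => ⟨hK _ h x hx, fun _ _ _ _ hF => hF _ h⟩⟩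
  | const a => exact ⟨U, subset_rfl, hU, hne, transfers_const a U⟩
  | add _ _ ihf ihg =>
    obtain ⟨U₁, s₁, o₁, n₁, t₁⟩ := ihf hU hne hK
    obtain ⟨U₂, s₂, o₂, n₂, t₂⟩ := ihg o₁ n₁ fun g hg x hx => hK g hg x (s₁ hx)
    refine ⟨U₂, s₂.trans s₁, o₂, n₂, fun x hx => ?_⟩
    obtain ⟨a₁, f₁⟩ := t₁ x (s₂ hx)
    obtain ⟨a₂, f₂⟩ := t₂ x hx
    exact ⟨a₁.add a₂, fun v η ω hv hF => (f₁ v η ω hv hF).add a₁ a₂ (f₂ v η ω hv hF)⟩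
  | sub _ _ ihf ihg =>
    obtain ⟨U₁, s₁, o₁, n₁, t₁⟩ := ihf hU hne hK
    obtain ⟨U₂, s₂, o₂, n₂, t₂⟩ := ihg o₁ n₁ fun g hg x hx => hK g hg x (s₁ hx)
    refine ⟨U₂, s₂.trans s₁, o₂, n₂, fun x hx => ?_⟩
    obtain ⟨a₁, f₁⟩ := t₁ x (s₂ hx)
    obtain ⟨a₂, f₂⟩ := t₂ x hx
    exact ⟨a₁.sub a₂, fun v η ω hv hF => (f₁ v η ω hv hF).sub hv a₁ a₂ (f₂ v η ω hv hF)⟩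
  | mul _ _ ihf ihg =>
    obtain ⟨U₁, s₁, o₁, n₁, t₁⟩ := ihf hU hne hK
    obtain ⟨U₂, s₂, o₂, n₂, t₂⟩ := ihg o₁ n₁ fun g hg x hx => hK g hg x (s₁ hx)
    refine ⟨U₂, s₂.trans s₁, o₂, n₂, fun x hx => ?_⟩
    obtain ⟨a₁, f₁⟩ := t₁ x (s₂ hx)
    obtain ⟨a₂, f₂⟩ := t₂ x hx
    exact ⟨a₁.mul a₂, fun v η ω hv hF => (f₁ v η ω hv hF).mul hv a₁ a₂ (f₂ v η ω hv hF)⟩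
  | @div f g _ _ ihf ihg =>
    obtain ⟨U₁, s₁, o₁, n₁, t₁⟩ := ihf hU hne hK
    obtain ⟨U₂, s₂, o₂, n₂, t₂⟩ := ihg o₁ n₁ fun g hg x hx => hK g hg x (s₁ hx)
    -- A denominator vanishing on the whole open set gives the constant 0 by convention; otherwise
    -- its nonvanishing set is open and nonempty.
    by_cases hz : ∀ x ∈ U₂, g x = 0
    · refine ⟨U₂, s₂.trans s₁, o₂, n₂, (transfers_const 0 U₂).congr o₂ fun x hx => ?_⟩
      simp [hz x hx]
    · push Not at hz
      refine ⟨U₂ ∩ g ⁻¹' {0}ᶜ, Set.inter_subset_left.trans (s₂.trans s₁),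
        t₂.continuousOn.isOpen_inter_preimage o₂ isOpen_compl_singleton, hz, fun x hx => ?_⟩
      obtain ⟨a₁, f₁⟩ := t₁ x (s₂ hx.1)
      obtain ⟨a₂, f₂⟩ := t₂ x hx.1
      exact ⟨a₁.div a₂ hx.2,
        fun v η ω hv hF => (f₁ v η ω hv hF).div hv a₁ a₂ hx.2 (f₂ v η ω hv hF)⟩
  | @branch f g h h' b _ _ _ _ hle hnle ihf ihg ihh ihh' =>
    obtain ⟨U₁, s₁, o₁, n₁, t₁⟩ := ihf hU hne hK
    obtain ⟨U₂, s₂, o₂, n₂, t₂⟩ := ihg o₁ n₁ fun g hg x hx => hK g hg x (s₁ hx)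
    have s₂' := s₂.trans s₁
    -- Either the comparison always succeeds here, or it fails on a nonempty open subset; in both
    -- cases only one branch remains.
    by_cases hz : ∀ x ∈ U₂, f x ≤ g x
    · obtain ⟨U₃, s₃, o₃, n₃, t₃⟩ := ihh o₂ n₂ fun g hg x hx => hK g hg x (s₂' hx)
      exact ⟨U₃, s₃.trans s₂', o₃, n₃, t₃.congr o₃ fun x hx => hle x (hz x (s₃ hx))⟩
    · push Not at hz
      have ho : IsOpen (U₂ ∩ (fun x => f x - g x) ⁻¹' Set.Ioi 0) :=
        ((t₁.mono s₂).continuousOn.sub t₂.continuousOn).isOpen_inter_preimage o₂ isOpen_Ioi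
      obtain ⟨y, hy, hy'⟩ := hz
      obtain ⟨U₃, s₃, o₃, n₃, t₃⟩ := ihh' ho ⟨y, hy, by simpa using hy'⟩
        fun g hg x hx => hK g hg x (s₂' hx.1)
      refine ⟨U₃, s₃.trans (Set.inter_subset_left.trans s₂'), o₃, n₃, t₃.congr o₃ fun x hx =>
        hnle x ?_⟩
      have := (s₃ hx).2
      simp only [Set.mem_preimage, Set.mem_Ioi, sub_pos] at this
      exact not_le.mpr this

/-- Simultaneous version of `Computable.exists_transfers` for finitely many computations. -/
theorem exists_transfers_finset {κ : Type*} (s : Finset κ) (K : κ → Set ((E → ℝ) → ℝ))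
    (f : κ → (E → ℝ) → ℝ) (hf : ∀ i ∈ s, Computable (K i) (f i)) {U : Set (E → ℝ)}
    (hU : IsOpen U) (hne : U.Nonempty) (hK : ∀ i ∈ s, ∀ g ∈ K i, ∀ x ∈ U, AnalyticAt ℝ g x) :
    ∃ U' ⊆ U, IsOpen U' ∧ U'.Nonempty ∧ ∀ i ∈ s, Transfers (K i) (f i) U' := by
  classical
  induction s using Finset.induction_on with
  | empty => exact ⟨U, subset_rfl, hU, hne, by simp⟩
  | insert a s ha ih =>
    obtain ⟨U₁, s₁, o₁, n₁, t₁⟩ := ih (fun i hi => hf i (Finset.mem_insert_of_mem hi))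
      fun i hi => hK i (Finset.mem_insert_of_mem hi)
    obtain ⟨U₂, s₂, o₂, n₂, t₂⟩ := (hf a (Finset.mem_insert_self _ _)).exists_transfers o₁ n₁
      fun g hg x hx => hK a (Finset.mem_insert_self _ _) g hg x (s₁ hx)
    refine ⟨U₂, s₂.trans s₁, o₂, n₂, fun i hi => ?_⟩
    rcases Finset.mem_insert.mp hi with rfl | hi
    · exact t₂
    · exact (t₁ i hi).mono s₂


/-! ### Traffic of a processor versus the critical path -/

section

variable {p : ℕ} {E : Type}

/-- The words that processor `q` sends or receives in the steps before `t`. -/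
def Schedule.traffic (S : Schedule p E) (t : ℕ) (q : Fin p) : Set ((E → ℝ) → ℝ) :=
  {f | ∃ s < t, ∃ r M, S.msg s r = some M ∧ (r = q ∨ M.dst = q) ∧ f ∈ M.words}

theorem Schedule.pathWords_succ_ge (S : Schedule p E) {t : ℕ} {q r : Fin p} {M : Message p E}
    (hM : S.msg t r = some M) (hq : r = q ∨ M.dst = q) :
    S.pathWords t q + M.words.length ≤ S.pathWords (t + 1) q := by
  have h1 : S.pathWords t q ≤ max (S.pathWords t r) (S.pathWords t M.dst) := by
    rcases hq with rfl | rfl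
    · exact le_max_left _ _
    · exact le_max_right _ _
  rw [Schedule.pathWords]
  refine le_trans ?_ (le_max_right _ _)
  refine le_trans ?_ (Finset.le_sup (Finset.mem_univ r))
  simp only [hM, if_pos hq]
  omega

theorem Schedule.pathWords_le_succ (S : Schedule p E) (t : ℕ) (q : Fin p) :
    S.pathWords t q ≤ S.pathWords (t + 1) q := by
  rw [Schedule.pathWords]
  exact le_max_left _ _

theorem finite_words_ncard_le (l : List ((E → ℝ) → ℝ)) :
    {f | f ∈ l}.Finite ∧ {f | f ∈ l}.ncard ≤ l.length := by
  classical
  have : {f | f ∈ l} = (l.toFinset : Set _) := by ext; simp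
  rw [this]
  exact ⟨Finset.finite_toSet _, by rw [Set.ncard_coe_finset]; exact l.toFinset_card_le⟩

/-- In one step `q` takes part in at most one outgoing and one incoming message, and each is no
longer than the increase of `pathWords` at `q`. These two may be simultaneous, hence the factor 2.
-/
theorem Algorithm.traffic_ncard_le (P : Algorithm p E) (q : Fin p) (t : ℕ) (ht : t ≤ P.steps) :
    (P.traffic t q).Finite ∧ (P.traffic t q).ncard ≤ 2 * P.pathWords t q := by
  induction t with
  | zero =>
    have : P.traffic 0 q = ∅ := by
      ext f; simp [Schedule.traffic]
    simp [this]
  | succ t ih =>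
    obtain ⟨hfin, hcard⟩ := ih (by omega)
    obtain ⟨d, hd⟩ : ∃ d, d = P.pathWords (t + 1) q - P.pathWords t q := ⟨_, rfl⟩
    have hmono := P.pathWords_le_succ t q
    -- `Q` selects the message sent by `q`, or the one received by `q`, in step `t`.
    have key : ∀ Q : Fin p → Message p E → Prop,
        (∀ r M, Q r M → P.msg t r = some M ∧ (r = q ∨ M.dst = q)) →
        (∀ r M r' M', Q r M → Q r' M' → M = M') →
        {f | ∃ r M, Q r M ∧ f ∈ M.words}.Finite ∧ {f | ∃ r M, Q r M ∧ f ∈ M.words}.ncard ≤ d := by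
      intro Q hQ huniq
      by_cases hex : ∃ r M, Q r M
      · obtain ⟨r, M, hrM⟩ := hex
        have he : {f | ∃ r M, Q r M ∧ f ∈ M.words} = {f | f ∈ M.words} := by
          ext f
          constructor
          · rintro ⟨r', M', h1, h2⟩
            rwa [huniq r' M' r M h1 hrM] at h2
          · exact fun h => ⟨r, M, hrM, h⟩
        rw [he]
        obtain ⟨h1, h2⟩ := finite_words_ncard_le M.words
        have := P.pathWords_succ_ge (hQ r M hrM).1 (hQ r M hrM).2
        exact ⟨h1, by omega⟩
      · have he : {f | ∃ r M, Q r M ∧ f ∈ M.words} = ∅ := by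
          ext f
          simp only [Set.mem_ofPred_eq, Set.mem_empty_iff_false, iff_false]
          rintro ⟨r, M, h, -⟩
          exact hex ⟨r, M, h⟩
        simp [he]
    obtain ⟨sfin, scard⟩ := key (fun r M => P.msg t r = some M ∧ r = q)
      (fun r M h => ⟨h.1, Or.inl h.2⟩) (by
        rintro r M r' M' ⟨h1, rfl⟩ ⟨h2, rfl⟩
        exact Option.some.inj (h1.symm.trans h2))
    obtain ⟨rfin, rcard⟩ := key (fun r M => P.msg t r = some M ∧ M.dst = q)
      (fun r M h => ⟨h.1, Or.inr h.2⟩) (by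
        rintro r M r' M' ⟨h1, h3⟩ ⟨h2, h4⟩
        obtain rfl := P.receive_one t (by omega) r r' M M' h1 h2 (h3.trans h4.symm)
        exact Option.some.inj (h1.symm.trans h2))
    have hsub : P.traffic (t + 1) q ⊆ P.traffic t q ∪
        ({f | ∃ r M, (P.msg t r = some M ∧ r = q) ∧ f ∈ M.words} ∪
        {f | ∃ r M, (P.msg t r = some M ∧ M.dst = q) ∧ f ∈ M.words}) := by
      rintro f ⟨s, hs, r, M, h1, h2, h3⟩
      rcases Nat.lt_succ_iff_lt_or_eq.mp hs with hs | rfl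
      · exact Or.inl ⟨s, hs, r, M, h1, h2, h3⟩
      · rcases h2 with h2 | h2
        · exact Or.inr (Or.inl ⟨r, M, ⟨h1, h2⟩, h3⟩)
        · exact Or.inr (Or.inr ⟨r, M, ⟨h1, h2⟩, h3⟩)
    have hfin' := hfin.union (sfin.union rfin)
    refine ⟨hfin'.subset hsub, ?_⟩
    have h1 := Set.ncard_le_ncard hsub hfin'
    have h2 := Set.ncard_union_le (P.traffic t q)
      ({f | ∃ r M, (P.msg t r = some M ∧ r = q) ∧ f ∈ M.words} ∪
        {f | ∃ r M, (P.msg t r = some M ∧ M.dst = q) ∧ f ∈ M.words})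
    have h3 := Set.ncard_union_le {f | ∃ r M, (P.msg t r = some M ∧ r = q) ∧ f ∈ M.words}
        {f | ∃ r M, (P.msg t r = some M ∧ M.dst = q) ∧ f ∈ M.words}
    omega

theorem Algorithm.traffic_ncard_le_criticalPathWords (P : Algorithm p E) (q : Fin p) :
    (P.traffic P.steps q).Finite ∧ (P.traffic P.steps q).ncard ≤ 2 * P.criticalPathWords := by
  obtain ⟨h1, h2⟩ := P.traffic_ncard_le q P.steps le_rfl
  have : P.pathWords P.steps q ≤ P.criticalPathWords :=
    Finset.le_sup (f := fun q => P.pathWords P.steps q) (Finset.mem_univ q)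
  exact ⟨h1, by omega⟩

/-! ### Propagation of flatness through a run -/

theorem fderiv_coord (e : E) (x v : E → ℝ) : fderiv ℝ (fun x : E → ℝ => x e) x v = v e := by
  have := (ContinuousLinearMap.proj (R := ℝ) (φ := fun _ : E => ℝ) e).fderiv (x := x)
  have h : (fun x : E → ℝ => x e) =
    (ContinuousLinearMap.proj (R := ℝ) (φ := fun _ : E => ℝ) e : (E → ℝ) → ℝ) := rfl
  rw [h, this]
  rfl

variable [Fintype E]

theorem analyticAt_coord (e : E) (x : E → ℝ) : AnalyticAt ℝ (fun x : E → ℝ => x e) x :=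
  (ContinuousLinearMap.proj (R := ℝ) (φ := fun _ : E => ℝ) e).analyticAt x

theorem flat_coord {e : E} {x v η ω : E → ℝ} (h : v e = 0) :
    Flat v η ω (fun x : E → ℝ => x e) x := by
  refine ⟨by rw [fderiv_coord, h], ?_⟩
  simp [mixedDeriv, fderiv_coord]

theorem analyticAt_of_mem_stored {S : Schedule p E} {t : ℕ} {U : Set (E → ℝ)}
    (h : ∀ s < t, ∀ r M, S.msg s r = some M → ∀ f ∈ M.words, Transfers (S.stored s r) f U)
    {q : Fin p} {g : (E → ℝ) → ℝ} (hg : g ∈ S.stored t q) {x : E → ℝ} (hx : x ∈ U) :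
    AnalyticAt ℝ g x := by
  rcases hg with ⟨e, -, rfl⟩ | ⟨s, hs, r, M, h1, -, h2⟩
  · exact analyticAt_coord e x
  · exact (h s hs r M h1 g h2 x hx).1

/-- A run contains finitely many words, so the open set is shrunk finitely often, step by step. -/
theorem Algorithm.exists_transfers_words (P : Algorithm p E) {U : Set (E → ℝ)} (hU : IsOpen U)
    (hne : U.Nonempty) (t : ℕ) (ht : t ≤ P.steps) :
    ∃ U' ⊆ U, IsOpen U' ∧ U'.Nonempty ∧ ∀ s < t, ∀ r M, P.msg s r = some M →
      ∀ f ∈ M.words, Transfers (P.stored s r) f U' := by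
  induction t with
  | zero => exact ⟨U, subset_rfl, hU, hne, by simp⟩
  | succ t ih =>
    obtain ⟨U₁, s₁, o₁, n₁, t₁⟩ := ih (by omega)
    have hfin : {i : Fin p × ((E → ℝ) → ℝ) | ∃ M, P.msg t i.1 = some M ∧ i.2 ∈ M.words}.Finite := by
      have h : ∀ r : Fin p, {f | ∃ M, P.msg t r = some M ∧ f ∈ M.words}.Finite := by
        intro r
        rcases hM : P.msg t r with _ | M
        · simp
        · simp [(finite_words_ncard_le M.words).1]
      refine (Set.finite_iUnion fun r => (h r).image (Prod.mk r)).subset ?_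
      rintro ⟨r, f⟩ hf
      exact Set.mem_iUnion.mpr ⟨r, f, hf, rfl⟩
    obtain ⟨U₂, s₂, o₂, n₂, t₂⟩ := exists_transfers_finset hfin.toFinset
      (fun i => P.stored t i.1) (fun i => i.2) (by
        rintro ⟨r, f⟩ hi
        obtain ⟨M, h1, h2⟩ := hfin.mem_toFinset.mp hi
        exact P.computes_words t (by omega) r M h1 f h2) o₁ n₁
      fun i _ g hg x hx => analyticAt_of_mem_stored t₁ hg hx
    refine ⟨U₂, s₂.trans s₁, o₂, n₂, fun s hs r M hM f hf => ?_⟩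
    rcases Nat.lt_succ_iff_lt_or_eq.mp hs with hs | rfl
    · exact (t₁ s hs r M hM f hf).mono s₂
    · exact t₂ (r, f) (hfin.mem_toFinset.mpr ⟨M, hM, hf⟩)

/-- There is a nonempty open set of inputs on which all messages and all outputs are analytic and
transfer flatness. -/
theorem Algorithm.exists_transfers_outputs (P : Algorithm p E) {ι : Type} [Fintype ι]
    {loc : ι → Fin p} {out : (E → ℝ) → ι → ℝ} (hout : P.Outputs loc out) {U : Set (E → ℝ)}
    (hU : IsOpen U) (hne : U.Nonempty) :
    ∃ x ∈ U, (∀ s < P.steps, ∀ r M, P.msg s r = some M → ∀ f ∈ M.words,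
        Transfers (P.stored s r) f {x}) ∧
      ∀ e, Transfers (P.stored P.steps (loc e)) (fun x => out x e) {x} := by
  obtain ⟨U₁, s₁, o₁, n₁, t₁⟩ := P.exists_transfers_words hU hne P.steps le_rfl
  obtain ⟨U₂, s₂, o₂, ⟨x, hx⟩, t₂⟩ := exists_transfers_finset Finset.univ
    (fun e => P.stored P.steps (loc e)) (fun e x => out x e) (fun e _ => hout e) o₁ n₁
    fun i _ g hg x hx => analyticAt_of_mem_stored t₁ hg hx
  refine ⟨x, s₁ (s₂ hx), fun s hs r M hM f hf => (t₁ s hs r M hM f hf).mono ?_,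
    fun e => (t₂ e (Finset.mem_univ e)).mono ?_⟩
  · simpa using s₂ hx
  · simpa using hx

/-- A direction `η` of change of the input entries of `q` and a direction `ω` of change of the other
input entries which to first order do not change the traffic of `q`: then the words of `q` are flat
along `ω`, and the words of the other processors are flat along `η`. -/
theorem Algorithm.flat_stored (P : Algorithm p E) (q : Fin p) {x η ω : E → ℝ}
    (hx : ∀ s < P.steps, ∀ r M, P.msg s r = some M → ∀ f ∈ M.words,
        Transfers (P.stored s r) f {x})
    (hη : ∀ e, P.owner e ≠ q → η e = 0) (hω : ∀ e, P.owner e = q → ω e = 0)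
    (hη' : ∀ f ∈ P.traffic P.steps q, fderiv ℝ f x η = 0)
    (hω' : ∀ f ∈ P.traffic P.steps q, fderiv ℝ f x ω = 0) (t : ℕ) (ht : t ≤ P.steps) :
    (∀ g ∈ P.stored t q, Flat ω η ω g x) ∧ ∀ r ≠ q, ∀ g ∈ P.stored t r, Flat η η ω g x := by
  induction t using Nat.strong_induction_on with
  | _ t ih =>
    -- A message inherits the flatness of its sender: along ω if `q` sends it, along η otherwise.
    have sent : ∀ s < t, ∀ r M, P.msg s r = some M → ∀ f ∈ M.words,
        (r = q → Flat ω η ω f x) ∧ (r ≠ q → Flat η η ω f x) := by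
      intro s hs r M hM f hf
      obtain ⟨-, h2⟩ := hx s (by omega) r M hM f hf x rfl
      obtain ⟨i1, i2⟩ := ih s hs (by omega)
      constructor
      · rintro rfl
        exact h2 ω η ω (Or.inr rfl) i1
      · intro hr
        exact h2 η η ω (Or.inl rfl) (i2 r hr)
    constructor
    · rintro g (⟨e, he, rfl⟩ | ⟨s, hs, r, M, h1, h2, h3⟩)
      · exact flat_coord (hω e he)
      · have hr : r ≠ q := fun h => P.dst_ne s (by omega) r M h1 (h2.trans h.symm)
        exact ⟨hω' g ⟨s, by omega, r, M, h1, Or.inr h2, h3⟩, ((sent s hs r M h1 g h3).2 hr).2⟩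
    · rintro r' hr' g (⟨e, he, rfl⟩ | ⟨s, hs, r, M, h1, h2, h3⟩)
      · exact flat_coord (hη e (he ▸ hr'))
      · by_cases hr : r = q
        · exact ⟨hη' g ⟨s, by omega, r, M, h1, Or.inl hr, h3⟩, ((sent s hs r M h1 g h3).1 hr).2⟩
        · exact (sent s hs r M h1 g h3).2 hr

/-- Outputs on `q` are computed from words flat along ω, all others from words flat along η. Both
kinds of flatness include the mixed condition. -/
theorem Algorithm.flat_outputs (P : Algorithm p E) {ι : Type}
    {loc : ι → Fin p} {out : (E → ℝ) → ι → ℝ} (q : Fin p) {x η ω : E → ℝ}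
    (hx : ∀ s < P.steps, ∀ r M, P.msg s r = some M → ∀ f ∈ M.words,
        Transfers (P.stored s r) f {x})
    (hx' : ∀ e, Transfers (P.stored P.steps (loc e)) (fun x => out x e) {x})
    (hη : ∀ e, P.owner e ≠ q → η e = 0) (hω : ∀ e, P.owner e = q → ω e = 0)
    (hη' : ∀ f ∈ P.traffic P.steps q, fderiv ℝ f x η = 0)
    (hω' : ∀ f ∈ P.traffic P.steps q, fderiv ℝ f x ω = 0) (e : ι) :
    mixedDeriv η ω (fun x => out x e) x = 0 ∧
      (loc e ≠ q → fderiv ℝ (fun x => out x e) x η = 0) := by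
  obtain ⟨h1, h2⟩ := P.flat_stored q hx hη hω hη' hω' P.steps le_rfl
  obtain ⟨-, h3⟩ := hx' e x rfl
  by_cases he : loc e = q
  · exact ⟨(h3 ω η ω (Or.inr rfl) (he ▸ h1)).2, fun h => absurd he h⟩
  · have := h3 η η ω (Or.inl rfl) (h2 _ he)
    exact ⟨this.2, fun _ => this.1⟩

/-! ### Derivatives of the entries of a matrix product -/

section Bilinear

variable {I : Type*} [Fintype I] (a b : I → E) (x η ω : E → ℝ)

theorem fderiv_sum_mul_coord :
    fderiv ℝ (fun x : E → ℝ => ∑ i, x (a i) * x (b i)) x η =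
      ∑ i, (x (a i) * η (b i) + x (b i) * η (a i)) := by
  have hd : ∀ e : E, DifferentiableAt ℝ (fun x : E → ℝ => x e) x :=
    fun e => (analyticAt_coord e x).differentiableAt
  rw [fderiv_fun_sum fun i _ => (hd _).fun_mul (hd _)]
  simp only [sum_apply]
  refine Finset.sum_congr rfl fun i _ => ?_
  rw [fderiv_fun_mul (hd _) (hd _)]
  simp [fderiv_coord]

theorem mixedDeriv_sum_mul_coord :
    mixedDeriv η ω (fun x : E → ℝ => ∑ i, x (a i) * x (b i)) x =
      ∑ i, (η (a i) * ω (b i) + η (b i) * ω (a i)) := by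
  have hd : ∀ e : E, DifferentiableAt ℝ (fun x : E → ℝ => x e) x :=
    fun e => (analyticAt_coord e x).differentiableAt
  unfold mixedDeriv
  simp only [fderiv_sum_mul_coord]
  rw [fderiv_fun_sum fun i _ => ((hd _).mul_const _).fun_add ((hd _).mul_const _)]
  simp only [sum_apply]
  refine Finset.sum_congr rfl fun i _ => ?_
  rw [fderiv_fun_add ((hd _).mul_const _) ((hd _).mul_const _), fderiv_mul_const (hd _),
    fderiv_mul_const (hd _)]
  simp [fderiv_coord, mul_comm]

end Bilinear

end

/-! ### Generic minors, supports and orthogonal column spaces -/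

/-- A matrix with finitely many prescribed square submatrices invertible. -/
theorem exists_matrix_submatrix_det_ne_zero {I L J : Type*} [Fintype J]
    (r : J → ℕ) (e₁ : ∀ j, Fin (r j) → I) (e₂ : ∀ j, Fin (r j) → L)
    (h₁ : ∀ j, Function.Injective (e₁ j)) (h₂ : ∀ j, Function.Injective (e₂ j)) :
    ∃ W : Matrix I L ℝ, ∀ j, (W.submatrix (e₁ j) (e₂ j)).det ≠ 0 := by
  classical
  have hne : ∀ j, ((Matrix.mvPolynomialX I L ℝ).submatrix (e₁ j) (e₂ j)).det ≠ 0 := by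
    intro j
    have h := Matrix.det_mvPolynomialX_ne_zero (Fin (r j)) ℝ
    have hi := MvPolynomial.rename_injective (R := ℝ) _ ((h₁ j).prodMap (h₂ j))
    have he : (Matrix.mvPolynomialX I L ℝ).submatrix (e₁ j) (e₂ j) =
        (MvPolynomial.rename (R := ℝ) (Prod.map (e₁ j) (e₂ j))).mapMatrix
          (Matrix.mvPolynomialX (Fin (r j)) (Fin (r j)) ℝ) := by
      ext1 i l
      simp [Matrix.mvPolynomialX]
    rw [he, ← AlgHom.map_det]
    exact (map_ne_zero_iff _ hi).mpr h
  -- One nonroot of the product of these nonzero polynomials serves all minors at once.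
  have hprod : (∏ j, ((Matrix.mvPolynomialX I L ℝ).submatrix (e₁ j) (e₂ j)).det) ≠ 0 :=
    Finset.prod_ne_zero_iff.mpr fun j _ => hne j
  obtain ⟨w, hw⟩ : ∃ w, MvPolynomial.eval w
      (∏ j, ((Matrix.mvPolynomialX I L ℝ).submatrix (e₁ j) (e₂ j)).det) ≠ 0 := by
    by_contra! h
    exact hprod (MvPolynomial.funext fun w => by rw [h w, map_zero])
  refine ⟨Matrix.of fun i l => w (i, l), fun j => ?_⟩
  rw [map_prod, Finset.prod_ne_zero_iff] at hw
  have := hw j (Finset.mem_univ j)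
  rw [RingHom.map_det] at this
  convert this using 2
  ext i l
  simp [Matrix.mvPolynomialX]

open Module

theorem finrank_le_card_of_support {I : Type*} [Finite I] (Z : Submodule ℝ (I → ℝ)) (X : Finset I)
    (h : ∀ z ∈ Z, ∀ i ∉ X, z i = 0) : finrank ℝ Z ≤ X.card := by
  have hinj : Function.Injective
      ((LinearMap.funLeft ℝ ℝ (Subtype.val : X → I)).comp Z.subtype) := by
    rw [← LinearMap.ker_eq_bot, LinearMap.ker_eq_bot']
    rintro ⟨z, hz⟩ h0
    ext i
    by_cases hi : i ∈ X
    · exact congrFun h0 ⟨i, hi⟩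
    · exact h z hz i hi
  simpa using LinearMap.finrank_le_finrank_of_injective hinj

/-- Over ℝ, orthogonal subspaces meet only in 0, so their sum is direct, and it is supported on `X ∪
Y`. -/
theorem finrank_add_finrank_le_of_orthogonal {I : Type*} [Fintype I] [DecidableEq I]
    (A B : Submodule ℝ (I → ℝ)) (X Y : Finset I) (hA : ∀ z ∈ A, ∀ i ∉ X, z i = 0)
    (hB : ∀ z ∈ B, ∀ i ∉ Y, z i = 0) (h : ∀ a ∈ A, ∀ b ∈ B, ∑ i, a i * b i = 0) :
    finrank ℝ A + finrank ℝ B ≤ (X ∪ Y).card := by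
  have hinf : A ⊓ B = ⊥ := by
    rw [eq_bot_iff]
    rintro z ⟨h1, h2⟩
    have h3 := (Finset.sum_eq_zero_iff_of_nonneg fun i _ => mul_self_nonneg (z i)).mp (h z h1 z h2)
    rw [Submodule.mem_bot]
    ext i
    exact mul_self_eq_zero.mp (h3 i (Finset.mem_univ i))
  have h1 := Submodule.finrank_sup_add_finrank_inf_eq A B
  rw [hinf, finrank_bot, add_zero] at h1
  rw [← h1]
  refine finrank_le_card_of_support _ _ fun z hz i hi => ?_
  obtain ⟨a, ha, b, hb, rfl⟩ := Submodule.mem_sup.mp hz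
  simp only [Finset.mem_union, not_or] at hi
  simp [hA a ha i hi.1, hB b hb i hi.2]

/-- The space of the columns `l` of the matrices in `U`. -/
def column {I L : Type*} (U : Submodule ℝ (I × L → ℝ)) (l : L) : Submodule ℝ (I → ℝ) :=
  U.map (LinearMap.funLeft ℝ ℝ fun i => (i, l))

theorem column_support {I L : Type*} [Fintype I] [DecidableEq I] [DecidableEq L]
    {U : Submodule ℝ (I × L → ℝ)} {T : Finset (I × L)} (h : ∀ u ∈ U, ∀ e ∉ T, u e = 0) (l : L) :
    ∀ z ∈ column U l, ∀ i ∉ Finset.univ.filter (fun i => (i, l) ∈ T), z i = 0 := by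
  rintro z ⟨u, hu, rfl⟩ i hi
  exact h u hu (i, l) (by simpa using hi)

theorem finrank_le_sum_column {I L : Type*} [Fintype I] [Fintype L]
    (U : Submodule ℝ (I × L → ℝ)) : finrank ℝ U ≤ ∑ l, finrank ℝ (column U l) := by
  rw [← finrank_pi_fintype ℝ]
  let φ : U →ₗ[ℝ] (∀ l, column U l) := LinearMap.pi fun l =>
    (LinearMap.funLeft ℝ ℝ fun i => (i, l)).restrict fun u hu => Submodule.mem_map_of_mem hu
  refine LinearMap.finrank_le_finrank_of_injective (f := φ) ?_
  rw [← LinearMap.ker_eq_bot, LinearMap.ker_eq_bot']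
  rintro ⟨u, hu⟩ h0
  ext ⟨i, l⟩
  exact congrFun (congrArg Subtype.val (congrFun h0 l)) i

theorem card_eq_sum_card_column {I L : Type*} [Fintype I] [Fintype L] [DecidableEq I]
    [DecidableEq L] (T : Finset (I × L)) :
    T.card = ∑ l, (Finset.univ.filter fun i => (i, l) ∈ T).card := by
  rw [Finset.card_eq_sum_card_fiberwise (f := Prod.snd) (t := Finset.univ) (by simp)]
  refine Finset.sum_congr rfl fun l _ => ?_
  refine Finset.card_nbij' (fun e => e.1) (fun i => (i, l)) ?_ ?_ ?_ ?_
  · rintro ⟨i, l'⟩ h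
    simp only [Finset.coe_filter, Set.mem_ofPred_eq] at h
    obtain ⟨h, rfl⟩ := h
    simpa using h
  · intro i h
    simpa using h
  · rintro ⟨i, l'⟩ h
    simp only [Finset.coe_filter, Set.mem_ofPred_eq] at h
    simp [h.2]
  · intro i h
    rfl

/-- A space embeds in the product of its column spaces. Hence the codimensions of the columns in
their supports add up to at most the codimension of the whole space. -/
theorem sum_column_defect_le {I L : Type*} [Fintype I] [Fintype L] [DecidableEq I]
    [DecidableEq L] {U : Submodule ℝ (I × L → ℝ)} {T : Finset (I × L)} {w : ℕ}
    (h : ∀ u ∈ U, ∀ e ∉ T, u e = 0) (hw : T.card ≤ finrank ℝ U + w) :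
    ∑ l, ((Finset.univ.filter fun i => (i, l) ∈ T).card - finrank ℝ (column U l)) ≤ w := by
  have h1 := finrank_le_sum_column U
  have h2 : ∀ l, finrank ℝ (column U l) ≤ (Finset.univ.filter fun i => (i, l) ∈ T).card :=
    fun l => finrank_le_card_of_support _ _ (column_support h l)
  rw [Finset.sum_tsub_distrib _ fun l _ => h2 l, ← card_eq_sum_card_column]
  omega

/-- If all columns of the matrices in two spaces `U`, `V` of small codimension are orthogonal to
each other, the supports of these columns have small intersection. -/
theorem exists_defects {I J L : Type*} [Fintype I] [Fintype J] [Fintype L] [DecidableEq I]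
    [DecidableEq J] [DecidableEq L] {U : Submodule ℝ (I × L → ℝ)} {V : Submodule ℝ (I × J → ℝ)}
    {T : Finset (I × L)} {S : Finset (I × J)} {w : ℕ}
    (hU : ∀ u ∈ U, ∀ e ∉ T, u e = 0) (hUw : T.card ≤ finrank ℝ U + w)
    (hV : ∀ v ∈ V, ∀ e ∉ S, v e = 0) (hVw : S.card ≤ finrank ℝ V + w)
    (h : ∀ u ∈ U, ∀ v ∈ V, ∀ l j, ∑ i, u (i, l) * v (i, j) = 0) :
    ∃ (u : L → ℕ) (v : J → ℕ), ∑ l, u l ≤ w ∧ ∑ j, v j ≤ w ∧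
      ∀ j l, (Finset.univ.filter fun i => (i, j) ∈ S ∧ (i, l) ∈ T).card ≤ u l + v j := by
  -- The defects are the codimensions of the column spaces within their supports.
  -- Inclusion–exclusion turns the bound on the union of two supports into one on their
  -- intersection.
  refine ⟨_, _, sum_column_defect_le hU hUw, sum_column_defect_le hV hVw, fun j l => ?_⟩
  have h1 := finrank_add_finrank_le_of_orthogonal _ _ _ _ (column_support hU l)
    (column_support hV j) (by
      rintro _ ⟨u, hu, rfl⟩ _ ⟨v, hv, rfl⟩
      exact h u hu v hv l j)
  have h2 := Finset.card_union_add_card_inter (Finset.univ.filter fun i => (i, l) ∈ T)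
    (Finset.univ.filter fun i => (i, j) ∈ S)
  have h3 : (Finset.univ.filter fun i => (i, j) ∈ S ∧ (i, l) ∈ T) =
      (Finset.univ.filter fun i => (i, l) ∈ T) ∩ (Finset.univ.filter fun i => (i, j) ∈ S) := by
    ext i; simp [and_comm]
  rw [h3]
  omega

/-- The functions supported on `S` in the kernel of a map to a space of dimension `w` form a space
of dimension at least `|S| - w`. -/
theorem exists_supported_submodule_le_ker {Z κ : Type*} [Finite Z] [Fintype κ] (S : Finset Z)
    (Φ : (Z → ℝ) →ₗ[ℝ] κ → ℝ) :
    ∃ V : Submodule ℝ (Z → ℝ), V ≤ LinearMap.ker Φ ∧ (∀ v ∈ V, ∀ e ∉ S, v e = 0) ∧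
      S.card ≤ finrank ℝ V + Fintype.card κ := by
  let ext : (S → ℝ) →ₗ[ℝ] (Z → ℝ) := Function.ExtendByZero.linearMap ℝ Subtype.val
  have hext : Function.Injective ext := Function.extend_injective Subtype.val_injective (0 : Z → ℝ)
  refine ⟨(LinearMap.ker (Φ.comp ext)).map ext, ?_, ?_, ?_⟩
  · rintro _ ⟨c, hc, rfl⟩
    exact hc
  · rintro _ ⟨c, -, rfl⟩ e he
    exact Function.extend_apply' _ _ _ (by rintro ⟨⟨a, ha⟩, rfl⟩; exact he ha)
  · rw [← (Submodule.equivMapOfInjective ext hext _).finrank_eq]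
    have h1 := LinearMap.finrank_range_add_finrank_ker (Φ.comp ext)
    have h2 := Submodule.finrank_le (LinearMap.range (Φ.comp ext))
    simp only [finrank_fintype_fun_eq_card, Fintype.card_coe] at h1 h2
    omega

/-! ### Two constraints on the traffic of one processor -/

section Communication

variable {p : ℕ} {E : Type} {I J L : Type} [Fintype J]

/-- Nonvanishing of determinants is an open condition, so it is compatible with the later shrinking
to an open set where the algorithm is analytic. -/
theorem exists_generic_input {eW : I × L → E} (hW : Function.Injective eW)
    (r : J → ℕ) (e₁ : ∀ j, Fin (r j) → I) (e₂ : ∀ j, Fin (r j) → L)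
    (h₁ : ∀ j, Function.Injective (e₁ j)) (h₂ : ∀ j, Function.Injective (e₂ j)) :
    ∃ U : Set (E → ℝ), IsOpen U ∧ U.Nonempty ∧ ∀ x ∈ U, ∀ j,
      ((Matrix.of fun i l => x (eW (i, l))).submatrix (e₁ j) (e₂ j)).det ≠ 0 := by
  refine ⟨{x | ∀ j, ((Matrix.of fun i l => x (eW (i, l))).submatrix (e₁ j) (e₂ j)).det ≠ 0},
    ?_, ?_, fun x hx => hx⟩
  · simp only [Set.ofPred_forall]
    refine isOpen_iInter_of_finite fun j => ?_
    refine isOpen_ne_fun (Continuous.matrix_det ?_) continuous_const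
    refine continuous_matrix fun a b => ?_
    exact continuous_apply (eW (e₁ j a, e₂ j b))
  · obtain ⟨W, h⟩ := exists_matrix_submatrix_det_ne_zero r e₁ e₂ h₁ h₂
    refine ⟨Function.extend eW (fun e => W e.1 e.2) 0, fun j => ?_⟩
    have : (Matrix.of fun i l => Function.extend eW (fun e => W e.1 e.2) 0 (eW (i, l))) = W := by
      ext i l
      exact hW.extend_apply (fun e => W e.1 e.2) 0 (i, l)
    rw [this]
    exact h j

variable [Fintype E] [Fintype I] [Fintype L] [DecidableEq I] [DecidableEq J] [DecidableEq L]

/-- The derivatives of finitely many functions at `x`, as a linear map. -/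
noncomputable def derivMap (F : Set ((E → ℝ) → ℝ)) (x : E → ℝ) : (E → ℝ) →ₗ[ℝ] F → ℝ :=
  LinearMap.pi fun f => (fderiv ℝ f.1 x : (E → ℝ) →ₗ[ℝ] ℝ)

/-- The words that processor `q` exchanges in the multiplication of two matrices: the rank of the
part of the map `A ↦ WᵀA` from `q` to the other processors is bounded by the number of words, and
the part of the product of the columns of `A` on `q` with the columns of `W` on other processors is
bounded by two families of defects. -/
theorem Algorithm.communication_bounds (P : Algorithm p E) {eA : I × J → E} {eW : I × L → E}
    (hA : Function.Injective eA) (hW : Function.Injective eW) (hAW : ∀ a b, eA a ≠ eW b)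
    {loc : L × J → Fin p}
    (hout : P.Outputs loc fun x e => ∑ i, x (eW (i, e.1)) * x (eA (i, e.2))) (q : Fin p) :
    ∑ j, min (Finset.univ.filter fun i => P.owner (eA (i, j)) = q).card
        (Finset.univ.filter fun l => loc (l, j) ≠ q).card ≤ 2 * P.criticalPathWords ∧
    ∃ (u : L → ℕ) (v : J → ℕ), ∑ l, u l ≤ 2 * P.criticalPathWords ∧
      ∑ j, v j ≤ 2 * P.criticalPathWords ∧
      ∀ j l, (Finset.univ.filter fun i => P.owner (eA (i, j)) = q ∧ P.owner (eW (i, l)) ≠ q).card ≤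
        u l + v j := by
  obtain ⟨hfin, hcard⟩ := P.traffic_ncard_le_criticalPathWords q
  have : Fintype (P.traffic P.steps q) := hfin.fintype
  rw [← Nat.card_coe_set_eq, Nat.card_eq_fintype_card] at hcard
  -- For column `j`, `r j` is the size of the largest square block of W with rows at entries of A on
  -- `q` and columns at results off `q`.
  obtain ⟨r, hr⟩ : ∃ r : J → ℕ, ∀ j, r j =
      min (Finset.univ.filter fun i => P.owner (eA (i, j)) = q).card
        (Finset.univ.filter fun l => loc (l, j) ≠ q).card := ⟨_, fun _ => rfl⟩
  have hex₁ : ∀ j, ∃ e : Fin (r j) → I, Function.Injective e ∧ ∀ a, P.owner (eA (e a, j)) = q := by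
    intro j
    refine ⟨fun a => ((Finset.equivFin _).symm
      (Fin.castLE ((hr j).le.trans (min_le_left _ _)) a)).1, ?_, fun a => ?_⟩
    · exact Subtype.val_injective.comp ((Equiv.injective _).comp (Fin.castLE_injective _))
    · exact (Finset.mem_filter.mp ((Finset.equivFin _).symm
        (Fin.castLE ((hr j).le.trans (min_le_left _ _)) a)).2).2
  have hex₂ : ∀ j, ∃ e : Fin (r j) → L, Function.Injective e ∧ ∀ a, loc (e a, j) ≠ q := by
    intro j
    refine ⟨fun a => ((Finset.equivFin _).symm
      (Fin.castLE ((hr j).le.trans (min_le_right _ _)) a)).1, ?_, fun a => ?_⟩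
    · exact Subtype.val_injective.comp ((Equiv.injective _).comp (Fin.castLE_injective _))
    · exact (Finset.mem_filter.mp ((Finset.equivFin _).symm
        (Fin.castLE ((hr j).le.trans (min_le_right _ _)) a)).2).2
  choose e₁ h₁ ho₁ using hex₁
  choose e₂ h₂ ho₂ using hex₂
  obtain ⟨U, hU, hne, hdet⟩ := exists_generic_input hW r e₁ e₂ h₁ h₂
  obtain ⟨x, hxU, hx, hx'⟩ := P.exists_transfers_outputs hout hU hne
  constructor
  · simp only [← hr]
    by_contra! hlt
    let X := Σ j, Fin (r j)
    let eX : X → E := fun y => eA (e₁ y.1 y.2, y.1)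
    have heX : Function.Injective eX := by
      rintro ⟨j, a⟩ ⟨j', a'⟩ h
      obtain ⟨h3, h4⟩ := Prod.mk.inj (hA h)
      dsimp only at h3 h4
      subst h4
      rw [h₁ j h3]
    let Ψ : (X → ℝ) →ₗ[ℝ] _ := (derivMap (P.traffic P.steps q) x).comp
      (Function.ExtendByZero.linearMap ℝ eX)
    -- With more chosen entries of A than words of traffic, some nonzero change of these entries
    -- leaves the traffic stationary.
    obtain ⟨c, hc, hc0⟩ := (LinearMap.ker Ψ).exists_mem_ne_zero_of_ne_bot (by
      refine LinearMap.ker_ne_bot_of_finrank_lt ?_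
      simp only [finrank_fintype_fun_eq_card, X, Fintype.card_sigma, Fintype.card_fin]
      omega)
    apply hc0
    have hη : ∀ e, (∀ y, eX y ≠ e) → Function.extend eX c 0 e = 0 := fun e he =>
      Function.extend_apply' _ _ _ fun ⟨y, hy⟩ => he y hy
    have key : ∀ j, (fun a => c ⟨j, a⟩) = 0 := by
      intro j
      refine Matrix.eq_zero_of_vecMul_eq_zero (hdet x hxU j) ?_
      ext b
      -- Only the first-order conclusion is needed, so ω is 0. It says that the invertible block
      -- annihilates the part of `c` in column `j`.
      have h3 := (P.flat_outputs q (η := Function.extend eX c 0) (ω := 0) hx hx' (by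
        intro e he
        exact hη e (by rintro y rfl; exact he (ho₁ _ _))) (by simp)
        (fun f hf => congrFun hc ⟨f, hf⟩) (by simp) (e₂ j b, j)).2 (ho₂ j b)
      rw [fderiv_sum_mul_coord] at h3
      simp only [Pi.zero_apply]
      rw [← h3]
      simp only [Matrix.vecMul, dotProduct, Matrix.submatrix_apply, Matrix.of_apply]
      refine Finset.sum_of_injOn (e₁ j) (h₁ j).injOn (by simp [Set.MapsTo]) ?_ ?_
      · intro i _ hi
        rw [hη (eW _) fun y => hAW _ _, hη (eA _)]
        · simp
        · rintro ⟨j', a⟩ h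
          obtain ⟨h4, h5⟩ := Prod.mk.inj (hA h)
          dsimp only at h4 h5
          subst h5
          exact hi ⟨a, by simp, h4⟩
      · intro a _
        rw [hη (eW _) fun y => hAW _ _, heX.extend_apply c 0 ⟨j, a⟩]
        ring
    ext ⟨j, a⟩
    exact congrFun (key j) a
  -- `V` consists of changes of A on `q` and, below, `U` of changes of W off `q`, all invisible in
  -- the traffic to first order.
  · obtain ⟨V, hV1, hV2, hV3⟩ := exists_supported_submodule_le_ker
      (Finset.univ.filter fun e => P.owner (eA e) = q)
      ((derivMap (P.traffic P.steps q) x).comp (Function.ExtendByZero.linearMap ℝ eA))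
    obtain ⟨U, hU1, hU2, hU3⟩ := exists_supported_submodule_le_ker
      (Finset.univ.filter fun e => P.owner (eW e) ≠ q)
      ((derivMap (P.traffic P.steps q) x).comp (Function.ExtendByZero.linearMap ℝ eW))
    have h := exists_defects (w := 2 * P.criticalPathWords) hU2 (hU3.trans (by gcongr)) hV2 (hV3.trans (by gcongr)) (by
      intro u hu v hv l j
      have h3 := (P.flat_outputs q (η := Function.extend eA v 0) (ω := Function.extend eW u 0)
        hx hx' (by
          intro e he
          by_cases h : ∃ a, eA a = e
          · obtain ⟨a, rfl⟩ := h
            rw [hA.extend_apply]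
            exact hV2 v hv a (by simpa using he)
          · exact Function.extend_apply' _ _ _ h) (by
          intro e he
          by_cases h : ∃ a, eW a = e
          · obtain ⟨a, rfl⟩ := h
            rw [hW.extend_apply]
            exact hU2 u hu a (by simpa using he)
          · exact Function.extend_apply' _ _ _ h)
        (fun f hf => congrFun (hV1 hv) ⟨f, hf⟩) (fun f hf => congrFun (hU1 hu) ⟨f, hf⟩) (l, j)).1
      rw [mixedDeriv_sum_mul_coord] at h3
      rw [← h3]
      refine Finset.sum_congr rfl fun i _ => ?_
      rw [hA.extend_apply, hW.extend_apply, Function.extend_apply' v (0 : E → ℝ) (eW _)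
        (by rintro ⟨a, h⟩; exact hAW _ _ h)]
      simp [mul_comm])
    simpa only [Finset.mem_filter, Finset.mem_univ, true_and] using h

end Communication

/-! ### Counting nonlocal products -/

section Counting

variable {I J L : Type} [Fintype I] [Fintype J] [Fintype L] {p : ℕ}

/-- If no processor owns more than two thirds of the third matrix, at most five sixths of the
products of a matrix multiplication have all their three entries on one processor. -/
theorem card_local_products_le (a : I × J → Fin p) (b : I × L → Fin p) (o : L × J → Fin p)
    (hO : ∀ q, 3 * (Finset.univ.filter fun e => o e = q).card ≤
      2 * (Fintype.card L * Fintype.card J)) :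
    6 * (Finset.univ.filter fun e : (I × J) × L =>
        b (e.1.1, e.2) = a e.1 ∧ o (e.2, e.1.2) = a e.1).card ≤
      5 * (Fintype.card I * Fintype.card J * Fintype.card L) := by
  classical
  set M := Fintype.card I * Fintype.card J * Fintype.card L with hM
  let f : I × J → ℕ := fun e =>
    (Finset.univ.filter fun l => b (e.1, l) = a e ∧ o (l, e.2) = a e).card
  have h1 : (Finset.univ.filter fun e : (I × J) × L =>
        b (e.1.1, e.2) = a e.1 ∧ o (e.2, e.1.2) = a e.1).card = ∑ e, f e := by
    simp only [f, Finset.card_filter, Fintype.sum_prod_type]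
  -- If `l` and `l'` both give local products at (i, j), then `b (i, l)` and `o (l', j)` both equal
  -- `a (i, j)`. This eliminates `a`, so no balance of the first matrix is needed.
  have h2 : ∀ e, f e ^ 2 ≤ ∑ l, (Finset.univ.filter fun l' => o (l', e.2) = b (e.1, l)).card := by
    intro e
    have hle : f e ^ 2 ≤
        (Finset.univ.filter fun d : L × L => o (d.2, e.2) = b (e.1, d.1)).card := by
      rw [sq, ← Finset.card_product]
      refine Finset.card_le_card fun d hd => ?_
      simp only [Finset.mem_product, Finset.mem_filter, Finset.mem_univ, true_and] at hd ⊢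
      rw [hd.1.1, hd.2.2]
    refine hle.trans (le_of_eq ?_)
    simp only [Finset.card_filter, Fintype.sum_prod_type]
  have h3 : ∑ e : I × J, ∑ l, (Finset.univ.filter fun l' => o (l', e.2) = b (e.1, l)).card =
      ∑ d : I × L, (Finset.univ.filter fun e => o e = b d).card := by
    simp only [Finset.card_filter, Fintype.sum_prod_type]
    refine Finset.sum_congr rfl fun i _ => ?_
    rw [Finset.sum_comm]
    exact Finset.sum_congr rfl fun l _ => Finset.sum_comm
  have h4 : 3 * ∑ d : I × L, (Finset.univ.filter fun e => o e = b d).card ≤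
      Fintype.card I * Fintype.card L * (2 * (Fintype.card L * Fintype.card J)) := by
    rw [Finset.mul_sum]
    refine (Finset.sum_le_card_nsmul _ _ _ fun d _ => hO (b d)).trans (le_of_eq ?_)
    simp
  have h5 := sq_sum_le_card_mul_sum_sq (s := Finset.univ) (f := f)
  have h6 : ∑ e, f e ^ 2 ≤ ∑ d : I × L, (Finset.univ.filter fun e => o e = b d).card :=
    h3 ▸ Finset.sum_le_sum fun e _ => h2 e
  rw [h1]
  set F := ∑ e, f e
  simp only [Finset.card_univ, Fintype.card_prod, Nat.cast_id] at h5
  have h7 : 3 * F ^ 2 ≤ 2 * M ^ 2 := by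
    calc 3 * F ^ 2 ≤ 3 * (Fintype.card I * Fintype.card J * ∑ e, f e ^ 2) := by gcongr
      _ = Fintype.card I * Fintype.card J * (3 * ∑ e, f e ^ 2) := by ring
      _ ≤ Fintype.card I * Fintype.card J *
          (Fintype.card I * Fintype.card L * (2 * (Fintype.card L * Fintype.card J))) :=
        Nat.mul_le_mul_left _ ((Nat.mul_le_mul_left 3 h6).trans h4)
      _ = 2 * M ^ 2 := by rw [hM]; ring
  -- Here 2/3 = 24/36 < 25/36.
  have h8 : (6 * F) ^ 2 ≤ (5 * M) ^ 2 := by nlinarith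
  exact (Nat.pow_le_pow_iff_left two_ne_zero).mp h8

/-- Some processor owns the entry of the first matrix in an average share of the products which are
not local. -/
theorem exists_processor_nonlocal_products (hp : 0 < p) (a : I × J → Fin p) (b : I × L → Fin p)
    (o : L × J → Fin p)
    (hO : ∀ q, 3 * (Finset.univ.filter fun e => o e = q).card ≤
      2 * (Fintype.card L * Fintype.card J)) :
    ∃ q, Fintype.card I * Fintype.card J * Fintype.card L ≤ 6 * (p * ∑ j, ∑ l,
      (Finset.univ.filter fun i => a (i, j) = q ∧ ¬(b (i, l) = q ∧ o (l, j) = q)).card) := by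
  classical
  have : Nonempty (Fin p) := ⟨⟨0, hp⟩⟩
  let N : Fin p → ℕ := fun q => ∑ j, ∑ l,
      (Finset.univ.filter fun i => a (i, j) = q ∧ ¬(b (i, l) = q ∧ o (l, j) = q)).card
  obtain ⟨q, hq⟩ := Finite.exists_max N
  refine ⟨q, ?_⟩
  have h1 : ∑ q, N q ≤ p * N q := by
    refine (Finset.sum_le_card_nsmul _ _ _ fun r _ => hq r).trans (le_of_eq ?_)
    simp
  have h2 : ∑ q, N q = (Finset.univ.filter fun e : (I × J) × L =>
        ¬ (b (e.1.1, e.2) = a e.1 ∧ o (e.2, e.1.2) = a e.1)).card := by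
    rw [Finset.card_eq_sum_card_fiberwise (f := fun e => a e.1) (t := Finset.univ) (by simp)]
    refine Finset.sum_congr rfl fun q _ => ?_
    simp only [N, Finset.filter_filter, Finset.card_filter, Fintype.sum_prod_type]
    calc _ = ∑ j, ∑ i, ∑ l, (if a (i, j) = q ∧ ¬(b (i, l) = q ∧ o (l, j) = q) then 1 else 0) :=
          Finset.sum_congr rfl fun j _ => Finset.sum_comm
      _ = ∑ i, ∑ j, ∑ l, (if a (i, j) = q ∧ ¬(b (i, l) = q ∧ o (l, j) = q) then 1 else 0) :=
          Finset.sum_comm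
      _ = _ := by
          refine Finset.sum_congr rfl fun i _ => Finset.sum_congr rfl fun j _ =>
            Finset.sum_congr rfl fun l _ => if_congr ?_ rfl rfl
          constructor
          · rintro ⟨rfl, h⟩
            exact ⟨h, rfl⟩
          · rintro ⟨h, rfl⟩
            exact ⟨rfl, h⟩
  have h3 := card_local_products_le a b o hO
  have h4 := Finset.card_filter_add_card_filter_not (s := (Finset.univ : Finset ((I × J) × L)))
    (fun e => b (e.1.1, e.2) = a e.1 ∧ o (e.2, e.1.2) = a e.1)
  simp only [Finset.card_univ, Fintype.card_prod] at h4
  change _ ≤ 6 * (p * N q)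
  omega

/-- Counting products by columns `j` with many entries (more than `Y`) and rows `l` with many
entries (more than `R`) on a processor. -/
theorem sum_products_le (S v : J → ℝ) (t u : L → ℝ) (N : J → L → ℝ) (Q : L → J → Prop)
    [∀ l j, Decidable (Q l j)] {Y R w : ℝ} (hY : 0 < Y) (hR : 0 < R)
    (hS : ∀ j, 0 ≤ S j) (hv : ∀ j, 0 ≤ v j) (ht : ∀ l, 0 ≤ t l) (hu : ∀ l, 0 ≤ u l)
    (h₁ : ∀ j l, N j l ≤ S j) (h₂ : ∀ j l, ¬ Q l j → N j l ≤ t l + u l + v j)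
    (h₃ : ∀ j l, Q l j → N j l ≤ u l + v j) (hk : (Fintype.card L : ℝ) ≤ Y)
    (hw : ∑ j, min (S j) ((Finset.univ.filter fun l => ¬ Q l j).card : ℝ) ≤ w)
    (huw : ∑ l, u l ≤ w) (hvw : ∑ j, v j ≤ w) :
    ∑ j, ∑ l, N j l ≤ Y * w + (∑ j, S j) / Y * (∑ l, t l + w) + 2 * (Fintype.card L * w) + R * w +
      (∑ l, ((Finset.univ.filter fun j => Q l j).card : ℝ)) / R * ∑ j, S j := by
  classical
  let q : L → ℝ := fun l => ((Finset.univ.filter fun j => Q l j).card : ℝ)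
  let B : J → ℝ := fun j => if S j ≤ Y then 0 else 1
  let G : L → ℝ := fun l => if q l ≤ R then 0 else 1
  let A₁ : J → L → ℝ := fun j l => if S j ≤ Y ∧ ¬ Q l j then S j else 0
  let A₃ : J → L → ℝ := fun j l => if Q l j ∧ q l ≤ R then u l else 0
  have hB : ∀ j, 0 ≤ B j := fun j => by simp only [B]; split_ifs <;> norm_num
  have hB1 : ∀ j, B j ≤ 1 := fun j => by simp only [B]; split_ifs <;> norm_num
  have hG : ∀ l, 0 ≤ G l := fun j => by simp only [G]; split_ifs <;> norm_num
  have hq : ∀ l, 0 ≤ q l := fun l => Nat.cast_nonneg _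
  have hS0 : 0 ≤ ∑ j, S j := Finset.sum_nonneg fun j _ => hS j
  -- Results off `q` are split by whether column `j` is short (`A₁`) or long (`B`), results on `q`
  -- by whether row `l` is short (`A₃`) or long (`G`). Markov's inequality will bound the numbers of
  -- long columns and rows.
  have hsplit : ∀ j l, N j l ≤ A₁ j l + B j * (t l + u l + v j) + (A₃ j l + v j) + G l * S j := by
    intro j l
    have := hS j
    have := hv j
    have := ht l
    have := hu l
    have := h₁ j l
    have := h₂ j l
    have := h₃ j l
    by_cases c1 : Q l j <;> by_cases c2 : S j ≤ Y <;> by_cases c3 : q l ≤ R <;>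
      simp only [A₁, A₃, B, G, c1, c2, c3, if_true, if_false, not_true, not_false_iff, and_true,
        and_false, and_self, forall_true_left] at * <;> linarith
  have hw0 : 0 ≤ w := le_trans (Finset.sum_nonneg fun l _ => hu l) huw
  have e1 : ∑ j, ∑ l, A₁ j l ≤ Y * w := by
    -- For short columns both factors are at most `Y`, so their product is at most `Y` times the
    -- smaller one.
    have : ∀ j, ∑ l, A₁ j l ≤ Y * min (S j) ((Finset.univ.filter fun l => ¬ Q l j).card : ℝ) := by
      intro j
      have hc : ((Finset.univ.filter fun l => ¬ Q l j).card : ℝ) ≤ Y := by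
        refine le_trans ?_ hk
        exact_mod_cast Finset.card_le_univ _
      by_cases c : S j ≤ Y
      · have : ∑ l, A₁ j l = ((Finset.univ.filter fun l => ¬ Q l j).card : ℝ) * S j := by
          simp only [A₁, c, true_and, Finset.sum_ite, Finset.sum_const_zero, add_zero,
            Finset.sum_const, nsmul_eq_mul]
        rw [this]
        rcases min_cases (S j) ((Finset.univ.filter fun l => ¬ Q l j).card : ℝ) with h | h
        · rw [h.1]; exact mul_le_mul_of_nonneg_right hc (hS j)
        · rw [h.1, mul_comm]; exact mul_le_mul_of_nonneg_right c (Nat.cast_nonneg _)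
      · simp only [A₁, c, false_and, if_false, Finset.sum_const_zero]
        exact mul_nonneg hY.le (le_min (hS j) (Nat.cast_nonneg _))
    calc _ ≤ ∑ j, Y * min (S j) ((Finset.univ.filter fun l => ¬ Q l j).card : ℝ) :=
          Finset.sum_le_sum fun j _ => this j
      _ ≤ Y * w := by rw [← Finset.mul_sum]; gcongr
  have e2 : ∑ j, ∑ l, B j * (t l + u l + v j) ≤
      (∑ j, S j) / Y * (∑ l, t l + w) + Fintype.card L * w := by
    have hBs : ∑ j, B j ≤ (∑ j, S j) / Y := by
      rw [Finset.sum_div]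
      refine Finset.sum_le_sum fun j _ => ?_
      simp only [B]
      split_ifs with c
      · exact div_nonneg (hS j) hY.le
      · rw [le_div_iff₀ hY]; linarith
    have : ∀ j, ∑ l, B j * (t l + u l + v j) ≤
        B j * (∑ l, t l + w) + Fintype.card L * v j := by
      intro j
      rw [← Finset.mul_sum, Finset.sum_add_distrib, Finset.sum_add_distrib, mul_add]
      simp only [Finset.sum_const, Finset.card_univ, nsmul_eq_mul]
      have := mul_le_mul_of_nonneg_right (hB1 j) (mul_nonneg (Nat.cast_nonneg (Fintype.card L)) (hv j))
      have := mul_le_mul_of_nonneg_left (add_le_add_right huw (∑ l, t l)) (hB j)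
      linarith
    calc _ ≤ ∑ j, (B j * (∑ l, t l + w) + Fintype.card L * v j) :=
          Finset.sum_le_sum fun j _ => this j
      _ = (∑ j, B j) * (∑ l, t l + w) + Fintype.card L * ∑ j, v j := by
          rw [Finset.sum_add_distrib, Finset.sum_mul, Finset.mul_sum]
      _ ≤ _ := by
          have : 0 ≤ ∑ l, t l := Finset.sum_nonneg fun l _ => ht l
          gcongr
  have e3 : ∑ j, ∑ l, (A₃ j l + v j) ≤ R * w + Fintype.card L * w := by
    simp only [Finset.sum_add_distrib]
    gcongr
    · rw [Finset.sum_comm]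
      have : ∀ l, ∑ j, A₃ j l ≤ R * u l := by
        intro l
        by_cases c : q l ≤ R
        · simp only [A₃, c, and_true, Finset.sum_ite, Finset.sum_const_zero, add_zero,
            Finset.sum_const, nsmul_eq_mul]
          exact mul_le_mul_of_nonneg_right c (hu l)
        · simp only [A₃, c, and_false, if_false, Finset.sum_const_zero]
          exact mul_nonneg hR.le (hu l)
      calc _ ≤ ∑ l, R * u l := Finset.sum_le_sum fun l _ => this l
        _ ≤ R * w := by rw [← Finset.mul_sum]; gcongr
    · simp only [Finset.sum_const, Finset.card_univ, nsmul_eq_mul, ← Finset.mul_sum]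
      gcongr
  have e4 : ∑ j, ∑ l, G l * S j ≤ (∑ l, q l) / R * ∑ j, S j := by
    have hGs : ∑ l, G l ≤ (∑ l, q l) / R := by
      rw [Finset.sum_div]
      refine Finset.sum_le_sum fun l _ => ?_
      simp only [G]
      split_ifs with c
      · exact div_nonneg (hq l) hR.le
      · rw [le_div_iff₀ hR]; linarith
    calc _ = (∑ l, G l) * ∑ j, S j := by
          rw [Finset.sum_comm, Finset.sum_mul_sum]
      _ ≤ _ := by gcongr
  calc ∑ j, ∑ l, N j l
      ≤ ∑ j, ∑ l, (A₁ j l + B j * (t l + u l + v j) + (A₃ j l + v j) + G l * S j) :=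
        Finset.sum_le_sum fun j _ => Finset.sum_le_sum fun l _ => hsplit j l
    _ = ∑ j, ∑ l, A₁ j l + ∑ j, ∑ l, B j * (t l + u l + v j) + ∑ j, ∑ l, (A₃ j l + v j) +
        ∑ j, ∑ l, G l * S j := by
        simp only [Finset.sum_add_distrib]
    _ ≤ _ := by linarith

end Counting

/-! ### Choice of thresholds and constants -/

/-- The constant in the lower bound on the words which some processor exchanges. -/
noncomputable def trafficConst (c : ℝ) : ℝ := 1 / (24 * (48 * c * (c + 1) + 2 * (48 * c ^ 2) + 3))

theorem trafficConst_pos {c : ℝ} (hc : 1 ≤ c) : 0 < trafficConst c := by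
  unfold trafficConst; positivity

/-- With few words, the bound of `sum_products_le` is below the average number of products. -/
theorem products_bound_lt {c m n k p D w σ τ ρ : ℝ} (hc : 1 ≤ c) (hm : 0 < m) (hn : 0 < n)
    (hp : 0 < p) (hk : 1 ≤ k) (hD : 0 < D) (hDm : D ≤ m) (hDn : D ≤ n)
    (hDs : D ^ 2 ≤ m * n / p) (hks : k ^ 2 ≤ m * n / p) (hw0 : 0 ≤ w)
    (hw : w < trafficConst c * (k * D)) (hσ : σ ≤ 2 * c * (m * n / p)) (hσ0 : 0 ≤ σ)
    (hτ : τ ≤ c * (m * k) / p + 1) (hτ0 : 0 ≤ τ) (hρ : ρ ≤ c * (n * k) / p + 1) :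
    (48 * c * (c + 1) * (m * n / p) / D) * w + σ / (48 * c * (c + 1) * (m * n / p) / D) * (τ + w) +
      2 * (k * w) + (48 * c ^ 2 * (n / p + 1 / k)) * w + ρ / (48 * c ^ 2 * (n / p + 1 / k)) * σ <
      m * n / p * k / 6 := by
  set s := m * n / p with hs
  set ε := trafficConst c with hε
  have hε0 : 0 < ε := trafficConst_pos hc
  have hs1 : 1 ≤ s := by nlinarith
  have hk0 : 0 < k := by linarith
  have hc0 : 0 < c := by linarith
  have hDs' : D ≤ s := by nlinarith
  -- Arithmetic–geometric mean: both k² and D² are at most `s`.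
  have hkD : k * D ≤ s := by nlinarith [sq_nonneg (k - D)]
  have hssk : s ≤ s * k := by nlinarith
  have hDsk : D ≤ s * k := hDs'.trans hssk
  have hDmk : D * (m * k / p) ≤ s * k := by
    have : s * k = n * (m * k / p) := by rw [hs]; field_simp
    rw [this]
    gcongr
  have hDnk : D * (n * k / p) ≤ s * k := by
    have : s * k = m * (n * k / p) := by rw [hs]; field_simp
    rw [this]
    gcongr
  have b1 : (48 * c * (c + 1) * s / D) * w ≤ 48 * c * (c + 1) * (ε * (s * k)) := by
    calc _ ≤ (48 * c * (c + 1) * s / D) * (ε * (k * D)) := by gcongr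
      _ = _ := by field_simp
  have b2 : σ / (48 * c * (c + 1) * s / D) * (τ + w) ≤ 1 / 24 * (s * k) + ε * (s * k) := by
    calc _ ≤ (2 * c * s) / (48 * c * (c + 1) * s / D) *
          (c * (m * k) / p + 1 + ε * (k * D)) := by gcongr
      _ = 1 / (24 * (c + 1)) * (c * (D * (m * k / p)) + D + ε * (k * D ^ 2)) := by
          field_simp; ring
      _ ≤ 1 / (24 * (c + 1)) * (c * (s * k) + s * k + ε * (k * s)) := by gcongr
      _ = 1 / 24 * (s * k) + 1 / (24 * (c + 1)) * (ε * (s * k)) := by field_simp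
      _ ≤ _ := by
          have : 1 / (24 * (c + 1)) ≤ 1 := by
            rw [div_le_one (by positivity)]; linarith
          have := mul_le_mul_of_nonneg_right this (by positivity : 0 ≤ ε * (s * k))
          linarith
  have b3 : 2 * (k * w) ≤ 2 * (ε * (s * k)) := by
    calc 2 * (k * w) ≤ 2 * (k * (ε * (k * D))) := by gcongr
      _ ≤ 2 * (k * (ε * s)) := by gcongr
      _ = _ := by ring
  have b4 : (48 * c ^ 2 * (n / p + 1 / k)) * w ≤ 2 * (48 * c ^ 2) * (ε * (s * k)) := by
    calc _ ≤ (48 * c ^ 2 * (n / p + 1 / k)) * (ε * (k * D)) := by gcongr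
      _ = 48 * c ^ 2 * (ε * (D * (n * k / p) + D)) := by field_simp
      _ ≤ 48 * c ^ 2 * (ε * (s * k + s * k)) := by gcongr
      _ = _ := by ring
  have b5 : ρ / (48 * c ^ 2 * (n / p + 1 / k)) * σ ≤ 1 / 24 * (s * k) := by
    have hρ' : ρ ≤ c * k * (n / p + 1 / k) := by
      have : c * k * (n / p + 1 / k) = c * (n * k) / p + c := by field_simp
      linarith
    calc _ ≤ (c * k * (n / p + 1 / k)) / (48 * c ^ 2 * (n / p + 1 / k)) * (2 * c * s) := by gcongr
      _ = _ := by
        have : n / p + 1 / k ≠ 0 := by positivity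
        field_simp; norm_num
  -- The thresholds make the parts of `b2` and `b5` without `w` cost at most 1/24 of s·k each. All
  -- terms with `w` together cost another 1/24, and the total 1/8 is below 1/6.
  have hεC : ε * (48 * c * (c + 1) + 2 * (48 * c ^ 2) + 3) = 1 / 24 := by
    rw [hε, trafficConst]
    field_simp
  have hsk : 0 < s * k := by positivity
  have : (ε * (48 * c * (c + 1) + 2 * (48 * c ^ 2) + 3)) * (s * k) = 1 / 24 * (s * k) := by rw [hεC]
  nlinarith

/-! ### The lower bound for one product -/

section

variable {p : ℕ} {E : Type} [Fintype E] {I J L : Type} [Fintype I] [Fintype J] [Fintype L]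

theorem Balanced.card_le {ι : Type} [Fintype ι] {c : ℝ} {loc : ι → Fin p} (hc : 0 ≤ c)
    (h : Balanced c loc) (q : Fin p) :
    ((Finset.univ.filter fun e => loc e = q).card : ℝ) ≤ c * Fintype.card ι / p + 1 :=
  le_trans (by exact_mod_cast h q) (Nat.ceil_lt_add_one (by positivity)).le

/-- As p ≥ 2c, a share is at most half of the entries, rounded up. For N ≥ 2 entries this is at most
2N/3, with equality at N = 3; it fails at N = 1. -/
theorem Balanced.three_mul_card_le {ι : Type} [Fintype ι] {c : ℝ} {loc : ι → Fin p}
    (hcp : 2 * c ≤ p) (h2 : 2 ≤ Fintype.card ι) (h : Balanced c loc) (q : Fin p) :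
    3 * (Finset.univ.filter fun e => loc e = q).card ≤ 2 * Fintype.card ι := by
  have hp : (0 : ℝ) < p := by exact_mod_cast (Nat.zero_le _).trans_lt q.isLt
  have h3 : ⌈c * (Fintype.card ι : ℝ) / (p : ℝ)⌉₊ ≤ (Fintype.card ι + 1) / 2 := by
    rw [Nat.ceil_le, div_le_iff₀ hp]
    have h4 : (Fintype.card ι : ℝ) ≤ 2 * ((Fintype.card ι + 1) / 2 : ℕ) := by
      exact_mod_cast (by omega : Fintype.card ι ≤ 2 * ((Fintype.card ι + 1) / 2))
    have h5 : (0 : ℝ) ≤ ((Fintype.card ι + 1) / 2 : ℕ) := Nat.cast_nonneg _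
    have h6 : (0 : ℝ) ≤ Fintype.card ι := Nat.cast_nonneg _
    nlinarith
  have := (h q).trans h3
  omega

theorem sum_card_column {p : ℕ} (a : I × J → Fin p) (q : Fin p) :
    ∑ j, (Finset.univ.filter fun i => a (i, j) = q).card =
      (Finset.univ.filter fun e => a e = q).card := by
  simp only [Finset.card_filter, Fintype.sum_prod_type]
  exact Finset.sum_comm

theorem sum_card_row {p : ℕ} (a : I × J → Fin p) (q : Fin p) :
    ∑ i, (Finset.univ.filter fun j => a (i, j) = q).card =
      (Finset.univ.filter fun e => a e = q).card := by
  simp only [Finset.card_filter, Fintype.sum_prod_type]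

/-- The lower bound for an algorithm that computes `WᵀA`, for matrices of any shape. -/
theorem Algorithm.criticalPathWords_ge (P : Algorithm p E) {eA : I × J → E} {eW : I × L → E}
    (hA : Function.Injective eA) (hW : Function.Injective eW) (hAW : ∀ a b, eA a ≠ eW b)
    {loc : L × J → Fin p}
    (hout : P.Outputs loc fun x e => ∑ i, x (eW (i, e.1)) * x (eA (i, e.2)))
    {c D : ℝ} (hc : 1 ≤ c) (hcp : 2 * c ≤ p) (hbA : Balanced c fun e => P.owner (eA e))
    (hbW : Balanced c fun e => P.owner (eW e)) (hbO : Balanced c loc)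
    (hJ : 2 ≤ Fintype.card J) (hL : 1 ≤ Fintype.card L) (hD : 0 < D)
    (hDI : D ≤ Fintype.card I) (hDJ : D ≤ Fintype.card J)
    (hDs : D ^ 2 ≤ Fintype.card I * Fintype.card J / p)
    (hLs : (Fintype.card L : ℝ) ^ 2 ≤ Fintype.card I * Fintype.card J / p) :
    trafficConst c / 2 * (Fintype.card L * D) ≤ P.criticalPathWords := by
  classical
  have hc0 : 0 ≤ c := by linarith
  have hp : (0 : ℝ) < p := by linarith
  have hp' : 0 < p := by exact_mod_cast hp
  obtain ⟨q, hq⟩ := exists_processor_nonlocal_products hp' (fun e => P.owner (eA e))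
    (fun e => P.owner (eW e)) loc fun q => by
      have h := hbO.three_mul_card_le hcp (by rw [Fintype.card_prod]; nlinarith) q
      rwa [Fintype.card_prod] at h
  obtain ⟨h1, u, v, hu, hv, huv⟩ := P.communication_bounds hA hW hAW hout q
  by_contra! hlt
  set w : ℝ := 2 * (P.criticalPathWords : ℝ) with hw
  set s : ℝ := Fintype.card I * Fintype.card J / p with hs
  have hk1 : (1 : ℝ) ≤ Fintype.card L := by exact_mod_cast hL
  have hk0 : (0 : ℝ) < Fintype.card L := by linarith
  have hJ0 : (0 : ℝ) < Fintype.card J := hD.trans_le hDJ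
  have hI0 : (0 : ℝ) < Fintype.card I := hD.trans_le hDI
  have hs1 : 1 ≤ s := by nlinarith
  let S : J → ℕ := fun j => (Finset.univ.filter fun i => P.owner (eA (i, j)) = q).card
  let t : L → ℕ := fun l => (Finset.univ.filter fun i => P.owner (eW (i, l)) = q).card
  let N : J → L → ℕ := fun j l => (Finset.univ.filter fun i =>
    P.owner (eA (i, j)) = q ∧ ¬(P.owner (eW (i, l)) = q ∧ loc (l, j) = q)).card
  have hSs : ∑ j, S j = _ := sum_card_column (fun e => P.owner (eA e)) q
  have hts : ∑ l, t l = _ := sum_card_column (fun e => P.owner (eW e)) q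
  have hQs := sum_card_row loc q
  have hN₁ : ∀ j l, N j l ≤ S j := fun j l =>
    Finset.card_le_card fun i => by simp only [Finset.mem_filter]; tauto
  have hN₃ : ∀ j l, loc (l, j) = q → N j l ≤ u l + v j := by
    intro j l h
    refine le_trans (Finset.card_le_card fun i => ?_) (huv j l)
    simp only [Finset.mem_filter]
    tauto
  -- The W-entry of the product is either on `q`, counted by `t l`, or off `q`, counted by the
  -- defects.
  have hN₂ : ∀ j l, N j l ≤ t l + u l + v j := by
    intro j l
    have h := huv j l
    have : N j l ≤ ((Finset.univ.filter fun i => P.owner (eW (i, l)) = q) ∪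
        (Finset.univ.filter fun i => P.owner (eA (i, j)) = q ∧ P.owner (eW (i, l)) ≠ q)).card :=
      Finset.card_le_card fun i => by
        simp only [Finset.mem_filter, Finset.mem_union]
        tauto
    have := this.trans (Finset.card_union_le _ _)
    simp only [t]
    omega
  -- The 1 from rounding up is absorbed because s ≥ 1 and c ≥ 1.
  have hσ : ∑ j, (S j : ℝ) ≤ 2 * c * s := by
    have h := hbA.card_le hc0 q
    rw [← hSs] at h
    push_cast [Fintype.card_prod] at h
    have : c * ((Fintype.card I : ℝ) * Fintype.card J) / p = c * s := by rw [hs]; ring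
    nlinarith
  have hτ : ∑ l, (t l : ℝ) ≤ c * (Fintype.card I * Fintype.card L) / p + 1 := by
    have h := hbW.card_le hc0 q
    rw [← hts] at h
    push_cast [Fintype.card_prod] at h
    exact h
  have hρ : ∑ l, ((Finset.univ.filter fun j => loc (l, j) = q).card : ℝ) ≤
      c * (Fintype.card J * Fintype.card L) / p + 1 := by
    have h := hbO.card_le hc0 q
    rw [← hQs] at h
    push_cast [Fintype.card_prod] at h
    rwa [mul_comm (Fintype.card L : ℝ)] at h
  have hmin : ∑ j, min (S j) (Finset.univ.filter fun l => ¬ loc (l, j) = q).card ≤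
      2 * P.criticalPathWords := h1
  have hNq : Fintype.card I * Fintype.card J * Fintype.card L ≤ 6 * (p * ∑ j, ∑ l, N j l) := hq
  clear hq h1 huv
  clear_value S t N w s
  have hσ0 : 0 ≤ ∑ j, (S j : ℝ) := Finset.sum_nonneg fun _ _ => Nat.cast_nonneg _
  have hτ0 : 0 ≤ ∑ l, (t l : ℝ) := Finset.sum_nonneg fun _ _ => Nat.cast_nonneg _
  have hw0 : 0 ≤ w := by rw [hw]; positivity
  have hDs' : D ≤ s := by nlinarith
  have hkD : Fintype.card L * D ≤ s := by nlinarith [sq_nonneg ((Fintype.card L : ℝ) - D)]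
  have hkY : (Fintype.card L : ℝ) ≤ 48 * c * (c + 1) * s / D := by
    rw [le_div_iff₀ hD]
    have : 1 ≤ 48 * c * (c + 1) := by nlinarith
    nlinarith
  have key := sum_products_le (fun j => (S j : ℝ)) (fun j => (v j : ℝ)) (fun l => (t l : ℝ))
    (fun l => (u l : ℝ)) (fun j l => (N j l : ℝ)) (fun l j => loc (l, j) = q)
    (Y := 48 * c * (c + 1) * s / D) (R := 48 * c ^ 2 * (Fintype.card J / p + 1 / Fintype.card L))
    (w := w) (by positivity) (by positivity) (fun _ => Nat.cast_nonneg _)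
    (fun _ => Nat.cast_nonneg _) (fun _ => Nat.cast_nonneg _) (fun _ => Nat.cast_nonneg _)
    (fun j l => by exact_mod_cast hN₁ j l) (fun j l _ => by exact_mod_cast hN₂ j l)
    (fun j l h => by exact_mod_cast hN₃ j l h) hkY (by rw [hw]; exact_mod_cast hmin)
    (by rw [hw]; exact_mod_cast hu) (by rw [hw]; exact_mod_cast hv)
  have hfin := products_bound_lt (w := w) hc hI0 hJ0 hp hk1 hD hDI hDJ (hs ▸ hDs) (hs ▸ hLs) hw0
    (by linarith) (hs ▸ hσ) hσ0 hτ hτ0 hρ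
  rw [← hs] at hfin
  have hq' : (Fintype.card I : ℝ) * Fintype.card J * Fintype.card L ≤
      6 * (p * ∑ j, ∑ l, (N j l : ℝ)) := by exact_mod_cast hNq
  have hge : s * Fintype.card L / 6 ≤ ∑ j, ∑ l, (N j l : ℝ) := by
    have : s * Fintype.card L / 6 =
        (Fintype.card I : ℝ) * Fintype.card J * Fintype.card L / (6 * p) := by
      rw [hs]; field_simp
    rw [this, div_le_iff₀ (by positivity)]
    linarith
  linarith

end

theorem sqrt_mul_sq_div_eq {m n k p : ℝ} (hk : 0 ≤ k) :
    Real.sqrt (m * n * k ^ 2 / p) = k * Real.sqrt (m * n / p) := by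
  rw [mul_div_right_comm, mul_comm, Real.sqrt_mul (sq_nonneg k), Real.sqrt_sq hk]

end DistMM

theorem theorem1 (c : ℝ) (hc : 1 ≤ c) :
    ∃ α : ℝ, 0 < α ∧ ∀ m n k p : ℕ, k < n → n ≤ m → 2 * c ≤ (p : ℝ) →
      (k : ℝ) < Real.sqrt ((m : ℝ) * n / p) →
      ∀ P : DistMM.Algorithm p (DistMM.Entry m n k),
        DistMM.ComputesWtA P c ∨ DistMM.ComputesAHt P c →
        α * min (Real.sqrt ((m : ℝ) * n * (k : ℝ) ^ 2 / p)) ((n : ℝ) * k) ≤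
          (P.criticalPathWords : ℝ) := by
  refine ⟨DistMM.trafficConst c / 2, half_pos (DistMM.trafficConst_pos hc), ?_⟩
  intro m n k p hkn hnm hcp hks P hP
  rcases Nat.eq_zero_or_pos k with rfl | hk
  · simp
  have hp : (0 : ℝ) < p := by linarith
  -- This follows from 0 < k < n; it ensures that the result matrix has at least two entries.
  have hn : (2 : ℕ) ≤ n := by omega
  have hn0 : (0 : ℝ) < n := by exact_mod_cast (by omega : 0 < n)
  have hm0 : (0 : ℝ) < m := by exact_mod_cast (by omega : 0 < m)
  have hnm' : (n : ℝ) ≤ m := by exact_mod_cast hnm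
  have hs0 : (0 : ℝ) < (m : ℝ) * n / p := by positivity
  set D : ℝ := min (Real.sqrt ((m : ℝ) * n / p)) n with hD
  have hD0 : 0 < D := lt_min (Real.sqrt_pos.mpr hs0) hn0
  have hDn : D ≤ n := min_le_right _ _
  have hDs : D ^ 2 ≤ (m : ℝ) * n / p :=
    (Real.le_sqrt hD0.le hs0.le).mp (min_le_left _ _)
  have hks' : (k : ℝ) ^ 2 ≤ (m : ℝ) * n / p :=
    (Real.le_sqrt (Nat.cast_nonneg k) hs0.le).mp hks.le
  have hmin : min (Real.sqrt ((m : ℝ) * n * (k : ℝ) ^ 2 / p)) ((n : ℝ) * k) = k * D := by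
    rw [DistMM.sqrt_mul_sq_div_eq (Nat.cast_nonneg k), mul_comm (n : ℝ),
      ← mul_min_of_nonneg _ _ (Nat.cast_nonneg k)]
  rw [hmin]
  rcases hP with ⟨hbA, hbW, loc, hbO, hout⟩ | ⟨hbA, hbH, loc, hbO, hout⟩
  · have h := P.criticalPathWords_ge (I := Fin m) (J := Fin n) (L := Fin k) (eA := Sum.inl)
      (eW := fun e => Sum.inr (Sum.inl e)) Sum.inl_injective
      (Sum.inr_injective.comp Sum.inl_injective) (by simp) (loc := loc) hout (D := D) hc hcp
      hbA hbW hbO (by simpa using hn) (by rwa [Fintype.card_fin]) hD0 (by simpa using hDn.trans hnm')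
      (by simpa using hDn) (by simpa using hDs) (by simpa using hks')
    simpa using h
  -- The transpose of AHᵀ is HAᵀ, so Hᵀ plays the role of W and Aᵀ that of A. As D ≤ n ≤ m, the same
  -- D works after exchanging m and n.
  · have hswap : ∀ {a b : ℕ} {f : Fin a × Fin b → Fin p}, DistMM.Balanced c f →
        DistMM.Balanced c fun e : Fin b × Fin a => f e.swap := by
      intro a b f hf q
      have h := hf q
      simp only [Fintype.card_prod, Nat.cast_mul] at h ⊢
      rw [mul_comm (Fintype.card (Fin b) : ℝ)]
      refine le_trans (le_of_eq ?_) h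
      refine Finset.card_equiv (Equiv.prodComm _ _) ?_
      simp
    have h := P.criticalPathWords_ge (I := Fin n) (J := Fin m) (L := Fin k)
      (eA := fun e => Sum.inl e.swap) (eW := fun e => Sum.inr (Sum.inr e.swap))
      (Sum.inl_injective.comp Prod.swap_injective)
      (Sum.inr_injective.comp (Sum.inr_injective.comp Prod.swap_injective)) (by simp)
      (loc := fun e => loc e.swap) (fun e => by
        have h := hout e.swap
        convert h using 2 with x
        exact Finset.sum_congr rfl fun j _ => mul_comm _ _) (D := D) hc hcp
      (hswap hbA) (hswap hbH) (hswap hbO) (by simpa using hn.trans hnm) (by rwa [Fintype.card_fin]) hD0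
      (by simpa using hDn) (by simpa using hDn.trans hnm')
      (by simpa [mul_comm] using hDs) (by simpa [mul_comm] using hks')
    simpa using h
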